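/- Let $N,d\ge 1$ be integers, $T>0$, and let $G^N=G^N(\mathbb R^d)$ be the free nilpotent Lie group of step $N$ over $\mathbb R^d$ with identity $1_N$ and Carnot--Carathéodory metric $d(\cdot,\cdot)$. Let $C_o([0,T],G^N)$ be the space of continuous paths $\mathbf x:[0,T]\to G^N$ with $\mathbf x_0=1_N$, equipped with the uniform metric. For $q\ge 1$ let $$\|\mathbf x\|_{q\text{-var};[0,t]}=\sup_{D\subset[0,t]}\Big(\sum_{t_j\in D}d(\mathbf x_{t_j},\mathbf x_{t_{j+1}})^q\Big)^{1/q}\in[0,\infty],$$ let $C_o^{q\text{-var}}([0,T],G^N)$ be the set of $\mathbf x\in C_o([0,T],G^N)$ with $\|\mathbf x\|_{q\text{-var};[0,T]}<\infty$, equipped with the metric $d_{q\text{-var}}(\mathbf x,\mathbf y)=\sup_{D\subset[0,T]}\big(\sum_{t_j\in D}d(\mathbf x_{t_j}^{-1}\mathbf x_{t_{j+1}},\mathbf y_{t_j}^{-1}\mathbf y_{t_{j+1}})^q\big)^{1/q}$, and let $C_o^{0,q\text{-var}}([0,T],G^N)$ be the closure in it of the set of step-$N$ signature lifts $t\mapsto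 S_N(\gamma)_{0,t}$ of smooth paths $\gamma:[0,T]\to\mathbb R^d$ with $\gamma_0=0$. For $\mathbf x\in C_o^{q\text{-var}}([0,T],G^N)$ let $\lambda(t)=T\,\|\mathbf x\|^q_{q\text{-var};[0,t]}/\|\mathbf x\|^q_{q\text{-var};[0,T]}$ (and $\lambda(t)=t$ if $\mathbf x$ is constant), and let the Hölder reparametrisation $P_q(\mathbf x)$ be the unique continuous path with $P_q(\mathbf x)_{\lambda(t)}=\mathbf x_t$ for all $t\in[0,T]$. Proposition. Let $p\ge 1$ and let $(\mathbf X_n)_{n\ge 1}$ be a sequence of $C_o([0,T],G^N)$-valued random variables, with $\|\mathbf X_n\|_{p\text{-var};[0,T]}<\infty$ a.s. for each $n$, such that $(\|\mathbf X_n\|_{p\text{-var};[0,T]})_{n\ge 1}$ is a tight collection of real random variables. Suppose that $\mathbf X_n$ converges in law to $\mathbf X$ as $C_o([0,T],G^N)$-valued random variables. Then for every $p'>p$ one has $\|\mathbf X\|_{p'\text{-var};[0,T]}<\infty$ a.s.; moreover $P_{p'}(\mathbf X_n)$ (for every $n$) and $P_{p'}(\mathbf X)$ take values a.s. in $C_o^{0,p'\text{-var}}([0,T],G^N)$,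 and $P_{p'}(\mathbf X_n)$ converges in law to $P_{p'}(\mathbf X)$ as $C_o^{0,p'\text{-var}}([0,T],G^N)$-valued random variables. -/

import Mathlib

open MeasureTheory Filter Topology
open scoped ENNReal

/-- Words of length at most `N` in the letters `1, …, d`. -/
abbrev Word (d N : ℕ) : Type := {w : List (Fin d) // w.length ≤ N}

/-- The truncated tensor algebra `T^N(ℝ^d) = ⨁_{k ≤ N} (ℝ^d)^{⊗ k}`: a tensor is given by its
coordinates `a w` in the basis `e_w = e_{i_1} ⊗ ⋯ ⊗ e_{i_k}`, `w = (i_1, …, i_k)`, `k ≤ N`. -/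
def TruncTensor (d N : ℕ) : Type := Word d N → ℝ

namespace TruncTensor
variable {d N : ℕ}

@[ext] theorem ext {a b : TruncTensor d N} (h : ∀ w, a w = b w) : a = b := funext h

def takeWord (w : Word d N) (i : ℕ) : Word d N :=
  ⟨w.1.take i, by have h1 := w.2; have := List.length_take_le i w.1; simp; omega⟩

def dropWord (w : Word d N) (i : ℕ) : Word d N :=
  ⟨w.1.drop i, by have := w.2; simp; omega⟩

/-- The truncated tensor product: `(a ⊗ b)_w = ∑_{w = w' w''} a_{w'} b_{w''}`. -/
noncomputable instance : Mul (TruncTensor d N) :=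
  ⟨fun a b w => ∑ i ∈ Finset.range (w.1.length + 1), a (takeWord w i) * b (dropWord w i)⟩

noncomputable instance : One (TruncTensor d N) := ⟨fun w => if w.1 = [] then 1 else 0⟩

theorem mul_apply (a b : TruncTensor d N) (w : Word d N) :
    (a * b) w = ∑ i ∈ Finset.range (w.1.length + 1), a (takeWord w i) * b (dropWord w i) := rfl

theorem one_apply (w : Word d N) : (1 : TruncTensor d N) w = if w.1 = [] then 1 else 0 := rfl

theorem one_mul' (a : TruncTensor d N) : 1 * a = a := by
  ext w
  rw [mul_apply, Finset.sum_eq_single 0]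
  · simp [one_apply, takeWord, dropWord]
  · intro i hi h0
    have : w.1.take i ≠ [] := by
      simp only [Finset.mem_range] at hi
      intro h
      have := congrArg List.length h
      simp at this
      rcases this with h | h
      · exact h0 h
      · simp [h] at hi; omega
    simp [one_apply, takeWord, this]
  · simp

theorem mul_one' (a : TruncTensor d N) : a * 1 = a := by
  ext w
  rw [mul_apply, Finset.sum_eq_single w.1.length]
  · simp [one_apply, takeWord, dropWord]
  · intro i hi h0
    simp only [Finset.mem_range] at hi
    have : ¬ (w.1.length ≤ i) := by omega
    simp [one_apply, dropWord, this]
  · simp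

theorem mul_assoc' (a b c : TruncTensor d N) : a * b * c = a * (b * c) := by
  ext w
  simp only [mul_apply, Finset.sum_mul, Finset.mul_sum]
  rw [Finset.sum_sigma', Finset.sum_sigma']
  refine Finset.sum_bij' (fun x _ => ⟨x.2, x.1 - x.2⟩) (fun x _ => ⟨x.1 + x.2, x.1⟩) ?_ ?_ ?_ ?_ ?_
  · rintro ⟨i, j⟩ h
    simp [takeWord, dropWord] at h ⊢
    omega
  · rintro ⟨i, j⟩ h
    simp [takeWord, dropWord] at h ⊢
    omega
  · rintro ⟨i, j⟩ h
    simp [takeWord] at h ⊢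
    omega
  · rintro ⟨i, j⟩ h
    simp
  · rintro ⟨i, j⟩ h
    simp [takeWord] at h
    have hj : j ≤ i := by omega
    have e1 : takeWord (takeWord w i) j = takeWord w j := by
      apply Subtype.ext; simp [takeWord, List.take_take, hj]
    have e2 : dropWord (takeWord w i) j = takeWord (dropWord w j) (i - j) := by
      apply Subtype.ext; simp [takeWord, dropWord, List.drop_take]
    have e3 : dropWord (dropWord w j) (i - j) = dropWord w i := by
      apply Subtype.ext; simp [dropWord, List.drop_drop, hj]
    simp only [e1, e2, e3, mul_assoc]

noncomputable instance : Monoid (TruncTensor d N) where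
  mul_assoc := mul_assoc'
  one_mul := one_mul'
  mul_one := mul_one'

end TruncTensor

section Sig
variable {d N : ℕ}

/-- Iterated integrals of the absolutely continuous path `γ` with derivative `u`:
`iterInt u t (i_1, …, i_k) s = ∫_{s < r_1 < ⋯ < r_k < t} dγ^{i_1}_{r_1} ⋯ dγ^{i_k}_{r_k}`,
where `dγ^i_r = u^i_r dr`. -/
noncomputable def iterInt (u : ℝ → EuclideanSpace ℝ (Fin d)) (t : ℝ) : List (Fin d) → ℝ → ℝ
  | [], _ => 1
  | i :: w, s => ∫ r in s..t, u r i * iterInt u t w r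

theorem coord_integrable {u : ℝ → EuclideanSpace ℝ (Fin d)} {a b : ℝ}
    (hu : IntervalIntegrable u volume a b) (i : Fin d) :
    IntervalIntegrable (fun r => u r i) volume a b :=
  ⟨(EuclideanSpace.proj (𝕜 := ℝ) i).integrable_comp hu.1,
   (EuclideanSpace.proj (𝕜 := ℝ) i).integrable_comp hu.2⟩

theorem iterInt_continuous {u : ℝ → EuclideanSpace ℝ (Fin d)}
    (hu : ∀ a b, IntervalIntegrable u volume a b) (t : ℝ) (w : List (Fin d)) :
    Continuous (iterInt u t w) := by
  induction w with
  | nil => exact continuous_const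
  | cons i w ih =>
    have h : ∀ a b, IntervalIntegrable (fun r => u r i * iterInt u t w r) volume a b :=
      fun a b => (coord_integrable (hu a b) i).mul_continuousOn ih.continuousOn
    have := (intervalIntegral.continuous_primitive h t).neg
    refine this.congr fun s => ?_
    rw [iterInt, intervalIntegral.integral_symm]
    rfl

theorem iterInt_chen_aux {u : ℝ → EuclideanSpace ℝ (Fin d)}
    (hu : ∀ a b, IntervalIntegrable u volume a b) (m t : ℝ) (w : List (Fin d)) (s : ℝ) :
    iterInt u t w s = ∑ k ∈ Finset.range (w.length + 1),
      iterInt u m (w.take k) s * iterInt u t (w.drop k) m := by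
  induction w generalizing s with
  | nil => simp [iterInt]
  | cons i w ih =>
    have hI : ∀ (t' : ℝ) (v : List (Fin d)) (a b : ℝ),
        IntervalIntegrable (fun r => u r i * iterInt u t' v r) volume a b :=
      fun t' v a b => (coord_integrable (hu a b) i).mul_continuousOn
        (iterInt_continuous hu t' v).continuousOn
    rw [List.length_cons, Finset.sum_range_succ']
    simp only [List.take_succ_cons, List.drop_succ_cons, List.take_zero, List.drop_zero]
    have h1 : ∫ r in s..m, u r i * iterInt u t w r = ∑ k ∈ Finset.range (w.length + 1),
        iterInt u m (i :: w.take k) s * iterInt u t (w.drop k) m := by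
      simp only [iterInt, ← intervalIntegral.integral_mul_const]
      rw [← intervalIntegral.integral_finsetSum
        (fun k _ => (hI m (w.take k) s m).mul_const _)]
      refine intervalIntegral.integral_congr fun r _ => ?_
      simp only [ih r, Finset.mul_sum, mul_assoc]
    rw [← h1]
    simp only [iterInt, one_mul]
    exact (intervalIntegral.integral_add_adjacent_intervals (hI t w s m) (hI t w m t)).symm

theorem iterInt_congr {u v : ℝ → EuclideanSpace ℝ (Fin d)} {a b : ℝ}
    (h : ∀ r ∈ Set.Ioc a b, u r = v r) (w : List (Fin d)) {s t : ℝ} (hs : s ∈ Set.Icc a b)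
    (ht : t ∈ Set.Icc a b) :
    iterInt u t w s = iterInt v t w s := by
  induction w generalizing s with
  | nil => rfl
  | cons i w ih =>
    simp only [iterInt]
    refine intervalIntegral.integral_congr_ae (Eventually.of_forall fun r hr => ?_)
    rw [Set.mem_uIoc] at hr
    have hr' : r ∈ Set.Ioc a b := by
      rcases hr with hr | hr
      · exact ⟨hs.1.trans_lt hr.1, hr.2.trans ht.2⟩
      · exact ⟨ht.1.trans_lt hr.1, hr.2.trans hs.2⟩
    rw [h r hr', ih ⟨hr'.1.le, hr'.2⟩]

theorem iterInt_affine (u : ℝ → EuclideanSpace ℝ (Fin d)) (k c a b : ℝ) (w : List (Fin d)) :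
    iterInt (fun r => k • u (k * r + c)) b w a = iterInt u (k * b + c) w (k * a + c) := by
  induction w generalizing a with
  | nil => rfl
  | cons i w ih =>
    simp only [iterInt, ih]
    rw [← intervalIntegral.smul_integral_comp_mul_add, ← intervalIntegral.integral_smul]
    simp [mul_assoc]

theorem intervalIntegrable_indicator {u : ℝ → EuclideanSpace ℝ (Fin d)}
    (hu : IntervalIntegrable u volume 0 1) (a b : ℝ) :
    IntervalIntegrable ((Set.Ioc (0 : ℝ) 1).indicator u) volume a b := by
  have : Integrable ((Set.Ioc (0 : ℝ) 1).indicator u) := by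
    rw [integrable_indicator_iff measurableSet_Ioc]
    exact (intervalIntegrable_iff_integrableOn_Ioc_of_le zero_le_one).1 hu
  exact this.intervalIntegrable

/-- Chen's relation. -/
theorem iterInt_chen {u : ℝ → EuclideanSpace ℝ (Fin d)} (hu : IntervalIntegrable u volume 0 1)
    {s m t : ℝ} (hs : s ∈ Set.Icc (0 : ℝ) 1) (hm : m ∈ Set.Icc (0 : ℝ) 1)
    (ht : t ∈ Set.Icc (0 : ℝ) 1) (w : List (Fin d)) :
    iterInt u t w s = ∑ k ∈ Finset.range (w.length + 1),
      iterInt u m (w.take k) s * iterInt u t (w.drop k) m := by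
  have h : ∀ r ∈ Set.Ioc (0 : ℝ) 1, u r = (Set.Ioc (0 : ℝ) 1).indicator u r :=
    fun r hr => (Set.indicator_of_mem hr u).symm
  rw [iterInt_congr h w hs ht, iterInt_chen_aux (intervalIntegrable_indicator hu) m t w s]
  exact Finset.sum_congr rfl fun k _ => by
    rw [iterInt_congr h _ hs hm, iterInt_congr h _ hm ht]

theorem abs_iterInt_le {u : ℝ → EuclideanSpace ℝ (Fin d)} (hu : IntervalIntegrable u volume 0 1)
    {s : ℝ} (hs : s ∈ Set.Icc (0 : ℝ) 1) (w : List (Fin d)) :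
    |iterInt u 1 w s| ≤ (∫ r in (0 : ℝ)..1, ‖u r‖) ^ w.length := by
  induction w generalizing s with
  | nil => simp [iterInt]
  | cons i w ih =>
    set L := ∫ r in (0 : ℝ)..1, ‖u r‖ with hL
    have hL0 : 0 ≤ L := intervalIntegral.integral_nonneg zero_le_one fun _ _ => norm_nonneg _
    have hsub : Set.uIcc s 1 ⊆ Set.uIcc (0 : ℝ) 1 := by
      rw [Set.uIcc_of_le hs.2, Set.uIcc_of_le zero_le_one]
      exact Set.Icc_subset_Icc_left hs.1
    have hus : IntervalIntegrable u volume s 1 := hu.mono_set hsub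
    have h1 : |iterInt u 1 (i :: w) s| ≤ ∫ r in s..1, ‖u r‖ * L ^ w.length := by
      rw [← Real.norm_eq_abs, iterInt]
      refine intervalIntegral.norm_integral_le_of_norm_le hs.2
        (Eventually.of_forall fun r hr => ?_) (hus.norm.mul_const _)
      rw [norm_mul]
      exact mul_le_mul (PiLp.norm_apply_le (u r) i) (ih ⟨hs.1.trans hr.1.le, hr.2⟩)
        (norm_nonneg _) (norm_nonneg _)
    refine h1.trans ?_
    rw [intervalIntegral.integral_mul_const, List.length_cons, pow_succ']
    refine mul_le_mul_of_nonneg_right ?_ (pow_nonneg hL0 _)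
    exact intervalIntegral.integral_mono_interval hs.1 hs.2 le_rfl
      (Eventually.of_forall fun _ => norm_nonneg _) hu.norm

/-- The step-`N` signature `S_N(γ)_{s,t} ∈ T^N(ℝ^d)` of the absolutely continuous path `γ` with
derivative `u`. -/
noncomputable def truncSig (N : ℕ) (u : ℝ → EuclideanSpace ℝ (Fin d)) (s t : ℝ) :
    TruncTensor d N := fun w => iterInt u t w.1 s

theorem truncSig_mul {u : ℝ → EuclideanSpace ℝ (Fin d)} (hu : IntervalIntegrable u volume 0 1)
    {s m t : ℝ} (hs : s ∈ Set.Icc (0 : ℝ) 1) (hm : m ∈ Set.Icc (0 : ℝ) 1)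
    (ht : t ∈ Set.Icc (0 : ℝ) 1) :
    truncSig N u s m * truncSig N u m t = truncSig N u s t :=
  TruncTensor.ext fun w => (iterInt_chen hu hs hm ht w.1).symm

theorem truncSig_self (u : ℝ → EuclideanSpace ℝ (Fin d)) (s : ℝ) : truncSig N u s s = 1 := by
  refine TruncTensor.ext fun w => ?_
  obtain ⟨w, hw⟩ := w
  cases w <;> simp [truncSig, iterInt, TruncTensor.one_apply]

theorem exists_concat {u v : ℝ → EuclideanSpace ℝ (Fin d)}
    (hu : IntervalIntegrable u volume 0 1) (hv : IntervalIntegrable v volume 0 1) :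
    ∃ c : ℝ → EuclideanSpace ℝ (Fin d), IntervalIntegrable c volume 0 1 ∧
      truncSig N c 0 1 = truncSig N u 0 1 * truncSig N v 0 1 ∧
      ∫ r in (0 : ℝ)..1, ‖c r‖ = (∫ r in (0 : ℝ)..1, ‖u r‖) + ∫ r in (0 : ℝ)..1, ‖v r‖ := by
  let c1 : ℝ → EuclideanSpace ℝ (Fin d) := fun r => (2 : ℝ) • u (2 * r + 0)
  let c2 : ℝ → EuclideanSpace ℝ (Fin d) := fun r => (2 : ℝ) • v (2 * r + (-1))
  let c : ℝ → EuclideanSpace ℝ (Fin d) := fun r => if r ≤ 1 / 2 then c1 r else c2 r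
  have e1 : ∀ r ∈ Set.Ioc (0 : ℝ) (1 / 2), c r = c1 r := fun r hr => if_pos hr.2
  have e2 : ∀ r ∈ Set.Ioc (1 / 2 : ℝ) 1, c r = c2 r := fun r hr => if_neg (not_le.2 hr.1)
  have i1 : IntervalIntegrable c1 volume 0 (1 / 2) := by
    have := (hu.comp_mul_left (c := 2)).smul (2 : ℝ)
    simpa [c1] using! this
  have i2 : IntervalIntegrable c2 volume (1 / 2) 1 := by
    have h3 := (hv.comp_add_right (-1)).comp_mul_left (c := 2)
    have := h3.smul (2 : ℝ)
    norm_num at this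
    simpa [c2] using! this
  have j1 : IntervalIntegrable c volume 0 (1 / 2) :=
    i1.congr (by rw [Set.uIoc_of_le (by norm_num)]; exact fun r hr => (e1 r hr).symm)
  have j2 : IntervalIntegrable c volume (1 / 2) 1 :=
    i2.congr (by rw [Set.uIoc_of_le (by norm_num)]; exact fun r hr => (e2 r hr).symm)
  have hc := j1.trans j2
  refine ⟨c, hc, ?_, ?_⟩
  · rw [← truncSig_mul (m := 1 / 2) hc (by norm_num) (by norm_num) (by norm_num)]
    congr 1
    · refine TruncTensor.ext fun w => ?_
      have := iterInt_affine u 2 0 0 (1 / 2) w.1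
      norm_num at this
      simp only [truncSig]
      rw [iterInt_congr e1 _ (by norm_num) (by norm_num), ← this]
      simp [c1]
    · refine TruncTensor.ext fun w => ?_
      have := iterInt_affine v 2 (-1) (1 / 2) 1 w.1
      norm_num at this
      simp only [truncSig]
      rw [iterInt_congr e2 _ (by norm_num) (by norm_num), ← this]
  · rw [← intervalIntegral.integral_add_adjacent_intervals j1.norm j2.norm]
    congr 1
    · have := intervalIntegral.smul_integral_comp_mul_add (a := 0) (b := 1 / 2)
        (fun r => ‖u r‖) 2 0
      norm_num at this
      rw [← this, ← intervalIntegral.integral_const_mul]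
      refine intervalIntegral.integral_congr_ae (Eventually.of_forall fun r hr => ?_)
      rw [Set.uIoc_of_le (by norm_num)] at hr
      rw [e1 r (by simpa using hr)]
      simp [c1, norm_smul]
    · have := intervalIntegral.smul_integral_comp_mul_add (a := 1 / 2) (b := 1)
        (fun r => ‖v r‖) 2 (-1)
      norm_num at this
      rw [← this, ← intervalIntegral.integral_const_mul]
      refine intervalIntegral.integral_congr_ae (Eventually.of_forall fun r hr => ?_)
      rw [Set.uIoc_of_le (by norm_num)] at hr
      rw [e2 r (by simpa using hr)]
      simp [c2, norm_smul]

theorem exists_reverse {u : ℝ → EuclideanSpace ℝ (Fin d)}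
    (hu : IntervalIntegrable u volume 0 1) :
    ∃ c : ℝ → EuclideanSpace ℝ (Fin d), IntervalIntegrable c volume 0 1 ∧
      truncSig N u 0 1 * truncSig N c 0 1 = 1 ∧
      ∫ r in (0 : ℝ)..1, ‖c r‖ = ∫ r in (0 : ℝ)..1, ‖u r‖ := by
  refine ⟨fun r => (-1 : ℝ) • u ((-1) * r + 1), ?_, ?_, ?_⟩
  · have := ((hu.comp_sub_left 1).symm).smul (-1 : ℝ)
    norm_num at this
    simpa [neg_add_eq_sub] using! this
  · have h : truncSig N (fun r => (-1 : ℝ) • u ((-1) * r + 1)) 0 1 = truncSig N u 1 0 := by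
      refine TruncTensor.ext fun w => ?_
      have := iterInt_affine u (-1) 1 0 1 w.1
      norm_num at this
      simp only [truncSig, ← this]
      norm_num
    rw [h, truncSig_mul hu (by norm_num) (by norm_num) (by norm_num), truncSig_self]
  · have := intervalIntegral.integral_comp_sub_left (a := 0) (b := 1) (fun r => ‖u r‖) 1
    norm_num at this
    rw [← this]
    simp [neg_add_eq_sub]

end Sig

/-- The free nilpotent Lie group `G^N(ℝ^d)` of step `N` over `ℝ^d`, realised inside `T^N(ℝ^d)` as
the group of step-`N` signatures `S_N(γ)_{0,1}` of absolutely continuous paths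
`γ : [0,1] → ℝ^d` (equivalently, after reparametrisation, of all continuous paths of finite
`1`-variation). Here `u` is the derivative of `γ`. -/
def freeNilpotentGroup (d N : ℕ) : Subgroup (TruncTensor d N)ˣ where
  carrier := {g | ∃ u : ℝ → EuclideanSpace ℝ (Fin d),
    IntervalIntegrable u volume 0 1 ∧ truncSig N u 0 1 = g.val}
  one_mem' := ⟨fun _ => 0, by simp, by
    refine TruncTensor.ext fun w => ?_
    obtain ⟨w, hw⟩ := w
    cases w <;> simp [truncSig, iterInt, TruncTensor.one_apply]⟩
  mul_mem' := by
    rintro a b ⟨u, hu, hua⟩ ⟨v, hv, hvb⟩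
    obtain ⟨c, hc, h, -⟩ := exists_concat (N := N) hu hv
    exact ⟨c, hc, by rw [h, hua, hvb]; rfl⟩
  inv_mem' := by
    rintro a ⟨u, hu, hua⟩
    obtain ⟨c, hc, h, -⟩ := exists_reverse (N := N) hu
    refine ⟨c, hc, ?_⟩
    rw [hua] at h
    exact (Units.inv_eq_of_mul_eq_one_right h).symm

abbrev FreeNilpotent (d N : ℕ) : Type := ↥(freeNilpotentGroup d N)

namespace FreeNilpotent
variable {d N : ℕ}

/-- The lengths of the absolutely continuous paths in `ℝ^d` whose signature is `g`. -/
def pathLengths (g : FreeNilpotent d N) : Set ℝ :=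
  {L | ∃ u : ℝ → EuclideanSpace ℝ (Fin d), IntervalIntegrable u volume 0 1 ∧
    truncSig N u 0 1 = g.val.val ∧ ∫ r in (0 : ℝ)..1, ‖u r‖ = L}

/-- The Carnot-Carathéodory norm. -/
noncomputable def ccNorm (g : FreeNilpotent d N) : ℝ := sInf (pathLengths g)

theorem pathLengths_nonempty (g : FreeNilpotent d N) : (pathLengths g).Nonempty := by
  obtain ⟨u, hu, h⟩ := g.2
  exact ⟨_, u, hu, h, rfl⟩

theorem pathLengths_nonneg (g : FreeNilpotent d N) {L : ℝ} (hL : L ∈ pathLengths g) : 0 ≤ L := by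
  obtain ⟨u, hu, h, rfl⟩ := hL
  exact intervalIntegral.integral_nonneg zero_le_one fun _ _ => norm_nonneg _

theorem pathLengths_bddBelow (g : FreeNilpotent d N) : BddBelow (pathLengths g) :=
  ⟨0, fun _ hL => pathLengths_nonneg g hL⟩

theorem ccNorm_one : ccNorm (1 : FreeNilpotent d N) = 0 := by
  refine le_antisymm (csInf_le (pathLengths_bddBelow _) ⟨fun _ => 0, by simp, ?_, by simp⟩)
    (le_csInf (pathLengths_nonempty _) fun L hL => pathLengths_nonneg _ hL)
  refine TruncTensor.ext fun w => ?_
  obtain ⟨w, hw⟩ := w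
  cases w <;> simp [truncSig, iterInt, TruncTensor.one_apply]

theorem ccNorm_inv_le (g : FreeNilpotent d N) : ccNorm g⁻¹ ≤ ccNorm g := by
  refine le_csInf (pathLengths_nonempty g) fun L hL => ?_
  obtain ⟨u, hu, h, rfl⟩ := hL
  obtain ⟨c, hc, hm, hl⟩ := exists_reverse (N := N) hu
  refine csInf_le (pathLengths_bddBelow _) ⟨c, hc, ?_, hl⟩
  rw [h] at hm
  exact (Units.inv_eq_of_mul_eq_one_right hm).symm

theorem ccNorm_mul_le (g h : FreeNilpotent d N) : ccNorm (g * h) ≤ ccNorm g + ccNorm h := by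
  have key : ∀ L ∈ pathLengths g, ∀ M ∈ pathLengths h, ccNorm (g * h) ≤ L + M := by
    rintro L ⟨u, hu, hug, rfl⟩ M ⟨v, hv, hvh, rfl⟩
    obtain ⟨c, hc, hm, hl⟩ := exists_concat (N := N) hu hv
    exact csInf_le (pathLengths_bddBelow _) ⟨c, hc, by rw [hm, hug, hvh]; rfl, hl⟩
  have h1 : ∀ L ∈ pathLengths g, ccNorm (g * h) - L ≤ ccNorm h := fun L hL =>
    le_csInf (pathLengths_nonempty h) fun M hM => by linarith [key L hL M hM]
  have h2 : ccNorm (g * h) - ccNorm h ≤ ccNorm g :=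
    le_csInf (pathLengths_nonempty g) fun L hL => by linarith [h1 L hL]
  linarith

theorem eq_one_of_ccNorm_eq_zero (g : FreeNilpotent d N) (hg : ccNorm g = 0) : g = 1 := by
  apply Subtype.ext
  apply Units.ext
  refine TruncTensor.ext fun w => ?_
  have hb : ∀ L ∈ pathLengths g, |g.val.val w| ≤ L ^ w.1.length := by
    rintro L ⟨u, hu, hug, rfl⟩
    rw [← hug]
    exact abs_iterInt_le hu (by norm_num) w.1
  rcases eq_or_ne w.1 [] with hw | hw
  · obtain ⟨u, hu, hug⟩ := g.2
    rw [← hug]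
    simp [truncSig, iterInt, TruncTensor.one_apply, hw]
  · have hlen : w.1.length ≠ 0 := by simpa using hw
    have h0 : g.val.val w = 0 := by
      by_contra hne
      have hpos : 0 < |g.val.val w| := abs_pos.2 hne
      have hcont : Tendsto (fun x : ℝ => x ^ w.1.length) (𝓝 0) (𝓝 0) := by
        have := (continuous_pow w.1.length).tendsto (0 : ℝ)
        rwa [zero_pow hlen] at this
      obtain ⟨ε, hε, hball⟩ := Metric.eventually_nhds_iff.1 (hcont.eventually_lt_const hpos)
      obtain ⟨L, hL, hLε⟩ := exists_lt_of_csInf_lt (pathLengths_nonempty g)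
        (show sInf (pathLengths g) < ε by rw [show sInf (pathLengths g) = 0 from hg]; exact hε)
      have hL0 := pathLengths_nonneg g hL
      have := hball (y := L) (by rwa [Real.dist_eq, sub_zero, abs_of_nonneg hL0])
      exact absurd (hb L hL) (not_le.2 this)
    rw [h0]
    simp [TruncTensor.one_apply, hw]

/-- `G^N(ℝ^d)` with the (left-invariant) Carnot-Carathéodory metric `d(g,h) = ‖g⁻¹ h‖`. -/
noncomputable instance : MetricSpace (FreeNilpotent d N) where
  dist g h := ccNorm (g⁻¹ * h)
  dist_self g := by simp [ccNorm_one]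
  dist_comm g h := by
    have key : ∀ a b : FreeNilpotent d N, ccNorm (a⁻¹ * b) ≤ ccNorm (b⁻¹ * a) := fun a b => by
      simpa using ccNorm_inv_le (b⁻¹ * a)
    exact le_antisymm (key g h) (key h g)
  dist_triangle g h k := by
    have := ccNorm_mul_le (g⁻¹ * h) (h⁻¹ * k)
    simpa [mul_assoc] using this
  eq_of_dist_eq_zero {g h} hgh := by
    have := eq_one_of_ccNorm_eq_zero _ hgh
    exact (inv_mul_eq_one.1 this)

end FreeNilpotent

section Variation

/-- Dissections of the part of `[0,T]` up to time `t`: a number `n` of intervals and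
nondecreasing points `t_0 ≤ t_1 ≤ ⋯` in `[0,t]`; only `t_0, …, t_n` matter. -/
abbrev Dissection {T : ℝ} (t : Set.Icc (0 : ℝ) T) : Type :=
  ℕ × {u : ℕ → Set.Icc (0 : ℝ) T // Monotone u ∧ ∀ i, u i ≤ t}

/-- The `p`-variation `‖x‖_{p-var;[0,t]} ∈ [0,∞]`. -/
noncomputable def pVarTo {E : Type*} [PseudoEMetricSpace E] {T : ℝ} (p : ℝ)
    (x : Set.Icc (0 : ℝ) T → E) (t : Set.Icc (0 : ℝ) T) : ℝ≥0∞ :=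
  ⨆ D : Dissection t,
    (∑ i ∈ Finset.range D.1, edist (x (D.2.1 i)) (x (D.2.1 (i + 1))) ^ p) ^ (1 / p)

/-- The `p`-variation `‖x‖_{p-var;[0,T]} ∈ [0,∞]`. -/
noncomputable def pVar {E : Type*} [PseudoEMetricSpace E] {T : ℝ} (p : ℝ)
    (x : Set.Icc (0 : ℝ) T → E) : ℝ≥0∞ :=
  ⨆ t, pVarTo p x t

/-- `λ_{p;x}(t) = T ‖x‖^p_{p-var;[0,t]} / ‖x‖^p_{p-var;[0,T]}`; for a constant path `x`, where this
quotient is `0/0`, the convention is `λ_{p;x}(t) = t`. -/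
noncomputable def holderTime {E : Type*} [PseudoEMetricSpace E] {T : ℝ} (p : ℝ)
    (x : Set.Icc (0 : ℝ) T → E) (t : Set.Icc (0 : ℝ) T) : ℝ :=
  open Classical in
  if pVar p x = 0 then t else T * (pVarTo p x t ^ p / pVar p x ^ p).toReal

/-- The Hölder reparametrisation `P_p(x)`: for `x` continuous of finite `p`-variation it is the
(unique) continuous path with `P_p(x)_{λ(t)} = x_t` for all `t`. The value is irrelevant for other
paths, and set to `x`. -/
noncomputable def holderReparam {E : Type*} [MetricSpace E] {T : ℝ} (p : ℝ)
    (x : C(Set.Icc (0 : ℝ) T, E)) : C(Set.Icc (0 : ℝ) T, E) :=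
  open Classical in
  if h : pVar p x < ∞ ∧ ∃ y : C(Set.Icc (0 : ℝ) T, E),
      ∀ s t : Set.Icc (0 : ℝ) T, (s : ℝ) = holderTime p x t → y s = x t
  then h.2.choose else x

end Variation

section PathSpaces
variable {d N : ℕ} {T : ℝ}

/-- `C_o([0,T], G^N)`: continuous paths started at the identity. -/
def BasedPath (d N : ℕ) (T : ℝ) : Type :=
  {x : C(Set.Icc (0 : ℝ) T, FreeNilpotent d N) // ∀ t : Set.Icc (0 : ℝ) T, (t : ℝ) = 0 → x t = 1}

/-- The uniform metric `d_∞`. -/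
noncomputable instance : MetricSpace (BasedPath d N T) :=
  inferInstanceAs (MetricSpace {x : C(Set.Icc (0 : ℝ) T, FreeNilpotent d N) //
    ∀ t : Set.Icc (0 : ℝ) T, (t : ℝ) = 0 → x t = 1})

noncomputable instance : MeasurableSpace (BasedPath d N T) := borel _

instance : BorelSpace (BasedPath d N T) := ⟨rfl⟩

/-- `C_o^{p-var}([0,T], G^N)`. -/
def PVarPath (d N : ℕ) (T p : ℝ) (_hp : 1 ≤ p) : Type :=
  {x : BasedPath d N T // pVar p x.1 < ∞}

/-- The homogeneous `p`-variation metric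
`d_{p-var}(x,y) = sup_D (∑ d(x_{t_i,t_{i+1}}, y_{t_i,t_{i+1}})^p)^{1/p}`, `x_{s,t} = x_s⁻¹ x_t`,
for paths with the same starting point. -/
noncomputable def pVarDist (p : ℝ) (x y : Set.Icc (0 : ℝ) T → FreeNilpotent d N) : ℝ≥0∞ :=
  ⨆ (t : Set.Icc (0 : ℝ) T) (D : Dissection t),
    (∑ i ∈ Finset.range D.1,
      edist ((x (D.2.1 i))⁻¹ * x (D.2.1 (i + 1))) ((y (D.2.1 i))⁻¹ * y (D.2.1 (i + 1))) ^ p)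
        ^ (1 / p)

theorem pVarDist_triangle {p : ℝ} (hp : 1 ≤ p)
    (x y z : Set.Icc (0 : ℝ) T → FreeNilpotent d N) :
    pVarDist p x z ≤ pVarDist p x y + pVarDist p y z := by
  refine iSup₂_le fun t D => ?_
  refine le_trans ?_ (add_le_add (le_iSup₂_of_le t D le_rfl) (le_iSup₂_of_le t D le_rfl))
  refine le_trans ?_ (ENNReal.Lp_add_le _ _ _ hp)
  gcongr
  exact edist_triangle _ _ _

theorem eq_of_pVarDist_eq_zero {p : ℝ} (hp : 1 ≤ p) (x y : BasedPath d N T)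
    (h : pVarDist p x.1 y.1 = 0) : x = y := by
  have hp0 : 0 < p := zero_lt_one.trans_le hp
  apply Subtype.ext
  ext1 t
  have hT : (0 : ℝ) ≤ T := t.2.1.trans t.2.2
  let o : Set.Icc (0 : ℝ) T := ⟨0, le_rfl, hT⟩
  let D : Dissection t := (1, ⟨fun i => if i = 0 then o else t, by
    constructor
    · intro i j hij
      by_cases hj : j = 0
      · have hi : i = 0 := by omega
        simp [hi, hj]
      · by_cases hi : i = 0
        · simp only [hi, hj, if_true, if_false]
          exact t.2.1
        · simp [hi, hj]
    · intro i
      by_cases hi : i = 0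
      · simp only [hi, if_true]
        exact t.2.1
      · simp [hi]⟩)
  have h1 := (le_iSup₂ (f := fun (t : Set.Icc (0 : ℝ) T) (D : Dissection t) =>
    (∑ i ∈ Finset.range D.1,
      edist ((x.1 (D.2.1 i))⁻¹ * x.1 (D.2.1 (i + 1)))
        ((y.1 (D.2.1 i))⁻¹ * y.1 (D.2.1 (i + 1))) ^ p) ^ (1 / p)) t D).trans h.le
  have hx : x.1 o = 1 := x.2 o rfl
  have hy : y.1 o = 1 := y.2 o rfl
  simpa [D, hx, hy, hp0, hp0.le, hp0.ne', not_lt.2 hp0.le] using h1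

noncomputable instance {p : ℝ} {hp : 1 ≤ p} : EMetricSpace (PVarPath d N T p hp) where
  edist x y := pVarDist p x.1.1 y.1.1
  edist_self x := by
    have hp0 : 0 < p := zero_lt_one.trans_le hp
    simp [pVarDist, hp0]
  edist_comm x y := by simp only [pVarDist, edist_comm]
  edist_triangle x y z := pVarDist_triangle hp _ _ _
  eq_of_edist_eq_zero {x y} h := Subtype.ext (eq_of_pVarDist_eq_zero hp _ _ h)

/-- The lifts `t ↦ S_N(γ)_{0,t}` of the smooth paths `γ : [0,T] → ℝ^d` with `γ_0 = 0`. -/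
def smoothLifts (d N : ℕ) (T p : ℝ) (hp : 1 ≤ p) : Set (PVarPath d N T p hp) :=
  {x | ∃ γ : ℝ → EuclideanSpace ℝ (Fin d), ContDiff ℝ ((⊤ : ℕ∞) : WithTop ℕ∞) γ ∧ γ 0 = 0 ∧
    ∀ t : Set.Icc (0 : ℝ) T, (x.1.1 t).val.val = truncSig N (deriv γ) 0 t}

/-- `C_o^{0,p-var}([0,T], G^N)`: the closure of the lifts of smooth paths in
`C_o^{p-var}([0,T], G^N)`. -/
def GeometricPath (d N : ℕ) (T p : ℝ) (hp : 1 ≤ p) : Type :=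
  ↥(closure (smoothLifts d N T p hp))

noncomputable instance {p : ℝ} {hp : 1 ≤ p} : EMetricSpace (GeometricPath d N T p hp) :=
  inferInstanceAs (EMetricSpace ↥(closure (smoothLifts d N T p hp)))

noncomputable instance {p : ℝ} {hp : 1 ≤ p} : MeasurableSpace (GeometricPath d N T p hp) := borel _

instance {p : ℝ} {hp : 1 ≤ p} : BorelSpace (GeometricPath d N T p hp) := ⟨rfl⟩

/-- The underlying continuous path. -/
def GeometricPath.path {p : ℝ} {hp : 1 ≤ p} (x : GeometricPath d N T p hp) :
    C(Set.Icc (0 : ℝ) T, FreeNilpotent d N) := x.1.1.1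

end PathSpaces

/-! The balls `B_R = {‖x‖_{p-var} ≤ R}` are closed for the uniform metric, and tightness puts all
but `ε` of the mass of every `X_n` into one of them. On `B_R` the map `P_{p'}` is continuous from
the uniform metric to `d_{p'-var}`, and a mapping theorem needing continuity only on such sets
(`tendstoInDistribution_comp_of_continuousOn`) gives the convergence. Portmanteau on the open
complements of the `B_R` shows that the limit also has finite `p`-variation a.s.

Continuity on `B_R` rests on interpolation, `∑ f^q ≤ (sup f)^{q-p} ∑ f^p` (`biVar_interpolation`):
uniformly close paths of bounded `p`-variation are close in `q`-variation, `q > p`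
(`exists_pVarDist_le`). Passing from close values to close increments in a noncommutative group
requires conjugation by bounded elements to be equicontinuous at `1`. This follows once the
Carnot-Carathéodory norm is known to be small when the coordinates are
(`exists_ccNorm_lt_of_coord_lt`), which is proved by removing one tensor level at a time. Closeness
in `q`-variation makes the time changes `λ` close, and since `P_q(y)` is `1/q`-Hölder the
reparametrised paths are uniformly close (`exists_dist_holderReparam_lt`). `P_q` does not increase
`p`-variation, so interpolation applies once more and yields closeness in `q`-variation.

`P_q(x)` lies in the closure of the smooth lifts by `mem_closure_smoothLifts`: almost geodesic
interpolation on fine grids keeps the `p`-variation bounded and converges uniformly, and the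
interpolants are lifts of integrable derivatives, which can be smoothed in `L¹`. -/

namespace TruncTensor
variable {d N : ℕ}

/-! ### Coordinate estimates in the truncated tensor algebra -/

instance : Finite (Word d N) := (List.finite_length_le (Fin d) N).to_subtype

theorem abs_mul_apply_le {a b : TruncTensor d N} {A B : ℝ} (hA : 0 ≤ A) (hB : 0 ≤ B)
    (ha : ∀ w, |a w| ≤ A) (hb : ∀ w, |b w| ≤ B) (w : Word d N) :
    |(a * b) w| ≤ (N + 1) * (A * B) := by
  rw [mul_apply]
  refine (Finset.abs_sum_le_sum_abs _ _).trans ?_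
  refine (Finset.sum_le_card_nsmul _ _ (A * B) fun i _ => ?_).trans ?_
  · rw [abs_mul]
    exact mul_le_mul (ha _) (hb _) (abs_nonneg _) hA
  · rw [Finset.card_range, nsmul_eq_mul]
    have : ((w.1.length + 1 : ℕ) : ℝ) ≤ N + 1 := by exact_mod_cast Nat.succ_le_succ w.2
    exact mul_le_mul_of_nonneg_right this (mul_nonneg hA hB)

theorem abs_mul_sub_mul_left_le {a b c : TruncTensor d N} {A δ : ℝ} (hA : 0 ≤ A) (hδ : 0 ≤ δ)
    (ha : ∀ w, |a w| ≤ A) (hbc : ∀ w, |b w - c w| ≤ δ) (w : Word d N) :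
    |(a * b) w - (a * c) w| ≤ (N + 1) * (A * δ) := by
  let e : TruncTensor d N := fun w => b w - c w
  have h : (a * b) w - (a * c) w = (a * e) w := by
    rw [mul_apply, mul_apply, mul_apply a e, ← Finset.sum_sub_distrib]
    exact Finset.sum_congr rfl fun i _ => (mul_sub _ _ _).symm
  rw [h]
  exact abs_mul_apply_le hA hδ ha hbc w

theorem abs_mul_sub_mul_right_le {a b c : TruncTensor d N} {A δ : ℝ} (hA : 0 ≤ A) (hδ : 0 ≤ δ)
    (ha : ∀ w, |a w| ≤ A) (hbc : ∀ w, |b w - c w| ≤ δ) (w : Word d N) :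
    |(b * a) w - (c * a) w| ≤ (N + 1) * (δ * A) := by
  let e : TruncTensor d N := fun w => b w - c w
  have h : (b * a) w - (c * a) w = (e * a) w := by
    rw [mul_apply, mul_apply, mul_apply e a, ← Finset.sum_sub_distrib]
    exact Finset.sum_congr rfl fun i _ => (sub_mul _ _ _).symm
  rw [h]
  exact abs_mul_apply_le hδ hA hbc ha w

/-- The components of `a` in the levels `1, …, k - 1` vanish. -/
def VanishesBelow (k : ℕ) (a : TruncTensor d N) : Prop :=
  ∀ w, w.1 ≠ [] → w.1.length < k → a w = 0

/-- When both parts of a splitting of `w` are nonempty, the left part is shorter than `k`, so `a`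
vanishes on it; only the two trivial splittings contribute. Up to level `k` the product is thus
additive. -/
theorem mul_apply_of_vanishesBelow {k : ℕ} {a b : TruncTensor d N} (ha : a.VanishesBelow k)
    (ha1 : ∀ w, w.1 = [] → a w = 1) (hb1 : ∀ w, w.1 = [] → b w = 1) (w : Word d N)
    (hw : w.1 ≠ []) (hk : w.1.length ≤ k) : (a * b) w = a w + b w := by
  have hl : w.1.length ≠ 0 := by simpa using hw
  rw [mul_apply, Finset.sum_range_succ, Finset.sum_eq_single_of_mem 0 (by simp; omega)]
  · have e0 : takeWord w 0 = ⟨[], by simp⟩ := Subtype.ext (by simp [takeWord])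
    have e1 : dropWord w 0 = w := Subtype.ext (by simp [dropWord])
    have e2 : takeWord w w.1.length = w := Subtype.ext (by simp [takeWord])
    have e3 : dropWord w w.1.length = ⟨[], by simp⟩ := Subtype.ext (by simp [dropWord])
    rw [e0, e1, e2, e3, ha1 ⟨[], by simp⟩ rfl, hb1 ⟨[], by simp⟩ rfl, one_mul, mul_one, add_comm]
  · intro i hi h0
    simp only [Finset.mem_range] at hi
    have h1 : (takeWord w i).1.length = i := by
      simp [takeWord]; omega
    rw [ha _ (fun h => h0 (by rw [← h1, h]; rfl)) (by omega), zero_mul]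

end TruncTensor

theorem iterInt_smul {d : ℕ} (c : ℝ) (u : ℝ → EuclideanSpace ℝ (Fin d)) (t s : ℝ)
    (w : List (Fin d)) :
    iterInt (fun r => c • u r) t w s = c ^ w.length * iterInt u t w s := by
  induction w generalizing s with
  | nil => simp [iterInt]
  | cons i w ih =>
    simp only [iterInt, ih, List.length_cons, ← intervalIntegral.integral_const_mul]
    refine intervalIntegral.integral_congr fun r _ => ?_
    simp only [PiLp.smul_apply, smul_eq_mul]
    ring

/-! ### Carnot-Carathéodory norm against coordinates -/

namespace FreeNilpotent
variable {d N : ℕ}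

/-- The coordinate of `g` on the word `w`. -/
def coord (g : FreeNilpotent d N) : TruncTensor d N := g.val.val

theorem coord_mul (g h : FreeNilpotent d N) : (g * h).coord = g.coord * h.coord := rfl

theorem coord_one : (1 : FreeNilpotent d N).coord = 1 := rfl

theorem coord_injective : Function.Injective (coord : FreeNilpotent d N → TruncTensor d N) :=
  fun _ _ h => Subtype.ext (Units.ext h)

theorem coord_nil (g : FreeNilpotent d N) (w : Word d N) (hw : w.1 = []) : g.coord w = 1 := by
  obtain ⟨u, hu, hug⟩ := g.2
  rw [coord, ← hug]
  simp [truncSig, iterInt, hw]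

theorem ccNorm_nonneg (g : FreeNilpotent d N) : 0 ≤ ccNorm g :=
  le_csInf (pathLengths_nonempty g) fun _ hL => pathLengths_nonneg g hL

theorem dist_eq (g h : FreeNilpotent d N) : dist g h = ccNorm (g⁻¹ * h) := rfl

theorem ccNorm_inv (g : FreeNilpotent d N) : ccNorm g⁻¹ = ccNorm g :=
  le_antisymm (ccNorm_inv_le g) (by simpa using ccNorm_inv_le g⁻¹)

theorem exists_length_lt {g : FreeNilpotent d N} {R : ℝ} (h : ccNorm g < R) :
    ∃ u : ℝ → EuclideanSpace ℝ (Fin d), IntervalIntegrable u volume 0 1 ∧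
      truncSig N u 0 1 = g.coord ∧ ∫ r in (0 : ℝ)..1, ‖u r‖ < R := by
  obtain ⟨L, ⟨u, hu, hug, rfl⟩, hL⟩ := exists_lt_of_csInf_lt (pathLengths_nonempty g) h
  exact ⟨u, hu, hug, hL⟩

theorem ccNorm_le_of_path {g : FreeNilpotent d N} {u : ℝ → EuclideanSpace ℝ (Fin d)}
    (hu : IntervalIntegrable u volume 0 1) (h : truncSig N u 0 1 = g.coord) :
    ccNorm g ≤ ∫ r in (0 : ℝ)..1, ‖u r‖ :=
  csInf_le (pathLengths_bddBelow g) ⟨u, hu, h, rfl⟩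

/-- The infimum defining the norm need not be attained, so a path of length below `R + 1` is used;
as `R + 1 ≥ 1`, the exponent `N` covers all levels. -/
theorem abs_coord_le {g : FreeNilpotent d N} {R : ℝ} (h : ccNorm g ≤ R) (w : Word d N) :
    |g.coord w| ≤ (R + 1) ^ N := by
  obtain ⟨u, hu, hug, hL⟩ := exists_length_lt (h.trans_lt (lt_add_one R))
  rw [← hug]
  have h0 : 0 ≤ ∫ r in (0 : ℝ)..1, ‖u r‖ :=
    intervalIntegral.integral_nonneg zero_le_one fun _ _ => norm_nonneg _
  have hR : 0 ≤ R := (ccNorm_nonneg g).trans h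
  calc |truncSig N u 0 1 w| ≤ (∫ r in (0 : ℝ)..1, ‖u r‖) ^ w.1.length :=
        abs_iterInt_le hu (by norm_num) w.1
    _ ≤ (R + 1) ^ w.1.length := pow_le_pow_left₀ h0 hL.le _
    _ ≤ (R + 1) ^ N := pow_le_pow_right₀ (by linarith) w.2

theorem abs_coord_lt {g : FreeNilpotent d N} {δ : ℝ} (hδ : δ ≤ 1) (h : ccNorm g < δ)
    (w : Word d N) (hw : w.1 ≠ []) : |g.coord w| < δ := by
  obtain ⟨u, hu, hug, hL⟩ := exists_length_lt h
  rw [← hug]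
  have h0 : 0 ≤ ∫ r in (0 : ℝ)..1, ‖u r‖ :=
    intervalIntegral.integral_nonneg zero_le_one fun _ _ => norm_nonneg _
  calc |truncSig N u 0 1 w| ≤ (∫ r in (0 : ℝ)..1, ‖u r‖) ^ w.1.length :=
        abs_iterInt_le hu (by norm_num) w.1
    _ ≤ (∫ r in (0 : ℝ)..1, ‖u r‖) ^ 1 :=
        pow_le_pow_of_le_one h0 (hL.le.trans hδ) (List.length_pos_iff.2 hw)
    _ < δ := by simpa using hL

/-- `exists_reverse` yields only right inverses; a right inverse that itself has a right inverse is
two-sided, so every signature is a unit. -/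
theorem exists_coord_eq {u : ℝ → EuclideanSpace ℝ (Fin d)} (hu : IntervalIntegrable u volume 0 1) :
    ∃ g : FreeNilpotent d N, g.coord = truncSig N u 0 1 := by
  obtain ⟨c, hc, hmul, -⟩ := exists_reverse (N := N) hu
  obtain ⟨e, he, hmul', -⟩ := exists_reverse (N := N) hc
  have hce : truncSig N c 0 1 * truncSig N u 0 1 = 1 := by
    have : truncSig N u 0 1 = truncSig N e 0 1 := by
      calc _ = truncSig N u 0 1 * (truncSig N c 0 1 * truncSig N e 0 1) := by
            rw [hmul', mul_one]
        _ = _ := by rw [← mul_assoc, hmul, one_mul]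
    rw [this, hmul']
  exact ⟨⟨⟨_, _, hmul, hce⟩, _, hu, rfl⟩, rfl⟩

/-- Scaling a path by `r` multiplies its length by `r` and its iterated integrals of order `m` by `r
^ m`. -/
theorem exists_dilation (g : FreeNilpotent d N) {r : ℝ} (hr : 0 ≤ r) :
    ∃ h : FreeNilpotent d N, (∀ w, h.coord w = r ^ w.1.length * g.coord w) ∧
      ccNorm h ≤ r * ccNorm g := by
  have key : ∀ u : ℝ → EuclideanSpace ℝ (Fin d), truncSig N u 0 1 = g.coord → ∀ w,
      truncSig N (fun s => r • u s) 0 1 w = r ^ w.1.length * g.coord w := fun u hu w => by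
    rw [← hu]
    exact iterInt_smul r u 1 0 w.1
  obtain ⟨u, hu, hug⟩ := g.2
  have hv : IntervalIntegrable (fun s => r • u s) volume 0 1 := hu.smul r
  obtain ⟨h, hh⟩ := exists_coord_eq (N := N) hv
  refine ⟨h, fun w => hh ▸ key u hug w, ?_⟩
  rcases hr.eq_or_lt with rfl | hr
  · refine (ccNorm_le_of_path hv hh.symm).trans ?_
    simp
  · rw [← div_le_iff₀' hr]
    refine le_csInf (pathLengths_nonempty g) ?_
    rintro L ⟨v, hv, hvg, rfl⟩
    rw [div_le_iff₀' hr]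
    refine (ccNorm_le_of_path (g := h) (u := fun s => r • v s) (hv.smul r) ?_).trans ?_
    · refine TruncTensor.ext fun w => ?_
      rw [key v hvg w, hh, key u hug w]
    · simp [norm_smul, abs_of_pos hr]

theorem coord_inv_of_vanishesBelow {k : ℕ} {g : FreeNilpotent d N}
    (hg : g.coord.VanishesBelow k) (w : Word d N) (hw : w.1 ≠ []) (hk : w.1.length ≤ k) :
    (g⁻¹).coord w = - g.coord w := by
  have h := TruncTensor.mul_apply_of_vanishesBelow hg (coord_nil g) (coord_nil g⁻¹) w hw hk
  rw [← coord_mul, mul_inv_cancel, coord_one, TruncTensor.one_apply, if_neg hw] at h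
  linarith

theorem vanishesBelow_inv {k : ℕ} {g : FreeNilpotent d N} (hg : g.coord.VanishesBelow k) :
    (g⁻¹).coord.VanishesBelow k := fun w hw hk => by
  rw [coord_inv_of_vanishesBelow hg w hw hk.le, hg w hw hk, neg_zero]

theorem coord_mul_of_vanishesBelow {k : ℕ} {g : FreeNilpotent d N}
    (hg : g.coord.VanishesBelow k) (h : FreeNilpotent d N) (w : Word d N) (hw : w.1 ≠ [])
    (hk : w.1.length ≤ k) : (g * h).coord w = g.coord w + h.coord w :=
  TruncTensor.mul_apply_of_vanishesBelow hg (coord_nil g) (coord_nil h) w hw hk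

theorem vanishesBelow_mul {k : ℕ} {g h : FreeNilpotent d N} (hg : g.coord.VanishesBelow k)
    (hh : h.coord.VanishesBelow k) : (g * h).coord.VanishesBelow k := fun w hw hk => by
  rw [coord_mul_of_vanishesBelow hg h w hw hk.le, hg w hw hk, hh w hw hk, add_zero]

theorem vanishesBelow_one (k : ℕ) : (1 : FreeNilpotent d N).coord.VanishesBelow k :=
  fun w hw _ => by rw [coord_one, TruncTensor.one_apply, if_neg hw]

/-- `g` lies in the `k`-th term of the filtration, with level-`k` component `l`. -/
def HasLevel (k : ℕ) (g : FreeNilpotent d N) (l : Word d N → ℝ) : Prop :=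
  g.coord.VanishesBelow k ∧ ∀ w, l w = if w.1.length = k then g.coord w else 0

theorem HasLevel.mul {k : ℕ} (hk : k ≠ 0) {g h : FreeNilpotent d N} {l m : Word d N → ℝ}
    (hg : HasLevel k g l) (hh : HasLevel k h m) : HasLevel k (g * h) (l + m) := by
  refine ⟨vanishesBelow_mul hg.1 hh.1, fun w => ?_⟩
  rw [Pi.add_apply, hg.2, hh.2]
  split_ifs with hw
  · rw [coord_mul_of_vanishesBelow hg.1 h w (by rintro h; simp [h] at hw; omega) hw.le]
  · simp

theorem HasLevel.one (k : ℕ) (hk : k ≠ 0) : HasLevel k (1 : FreeNilpotent d N) 0 := by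
  refine ⟨vanishesBelow_one k, fun w => ?_⟩
  split_ifs with hw
  · rw [coord_one, TruncTensor.one_apply, if_neg (by rintro h; simp [h] at hw; omega)]
    rfl
  · rfl

/-- Dilation by `|c|^{1/k}` multiplies level `k` by `|c|`, and inversion supplies the sign. The
exponent `1/k` in the norm bound still tends to `0` with `c`, which is all that is needed. -/
theorem HasLevel.exists_smul {k : ℕ} (hk : k ≠ 0) {g : FreeNilpotent d N} {l : Word d N → ℝ}
    (hg : HasLevel k g l) (c : ℝ) :
    ∃ h : FreeNilpotent d N, HasLevel k h (c • l) ∧ ccNorm h ≤ |c| ^ (1 / (k : ℝ)) * ccNorm g := by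
  have hpow : (|c| ^ (1 / (k : ℝ))) ^ k = |c| := by
    rw [one_div, Real.rpow_inv_natCast_pow (abs_nonneg c) hk]
  obtain ⟨h, hh, hn⟩ := exists_dilation g (Real.rpow_nonneg (abs_nonneg c) (1 / (k : ℝ)))
  have hv : h.coord.VanishesBelow k := fun w hw hwk => by rw [hh, hg.1 w hw hwk, mul_zero]
  rcases le_total 0 c with hc | hc
  · refine ⟨h, ⟨hv, fun w => ?_⟩, hn⟩
    rw [Pi.smul_apply, hg.2, smul_eq_mul]
    split_ifs with hw
    · rw [hh, hw, hpow, abs_of_nonneg hc]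
    · simp
  · refine ⟨h⁻¹, ⟨vanishesBelow_inv hv, fun w => ?_⟩, by rwa [ccNorm_inv]⟩
    rw [Pi.smul_apply, hg.2, smul_eq_mul]
    split_ifs with hw
    · rw [coord_inv_of_vanishesBelow hv w (by rintro h; simp [h] at hw; omega) hw.le, hh, hw,
        hpow, abs_of_nonpos hc]
      ring
    · simp

/-- The level-`k` components of the `k`-th term of the filtration form a vector space. -/
def levelSpace (d N k : ℕ) (hk : k ≠ 0) : Submodule ℝ (Word d N → ℝ) where
  carrier := {l | ∃ g : FreeNilpotent d N, HasLevel k g l}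
  zero_mem' := ⟨1, HasLevel.one k hk⟩
  add_mem' := fun ⟨g, hg⟩ ⟨h, hh⟩ => ⟨g * h, hg.mul hk hh⟩
  smul_mem' := fun c _ ⟨_, hg⟩ => let ⟨h, hh, _⟩ := hg.exists_smul hk c; ⟨h, hh⟩

/-- `levelSpace` is finite dimensional: lift a basis once, then reach any `l` by a product of
dilated lifts. The resulting bound `F l` on the norm is continuous in `l` and vanishes at `0`. The
element `h` shares only level `k` with `g`. -/
theorem exists_hasLevel_ccNorm_lt {k : ℕ} (hk : k ≠ 0) {ε : ℝ} (hε : 0 < ε) :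
    ∃ δ > 0, ∀ (g : FreeNilpotent d N) (l : Word d N → ℝ), HasLevel k g l →
      (∀ w, |l w| < δ) → ∃ h : FreeNilpotent d N, HasLevel k h l ∧ ccNorm h < ε := by
  have := Fintype.ofFinite (Word d N)
  let b := Module.finBasis ℝ (levelSpace d N k hk)
  have hb : ∀ i, ∃ g : FreeNilpotent d N, HasLevel k g (b i) := fun i => (b i).2
  choose γ hγ using hb
  let F : levelSpace d N k hk → ℝ := fun l => ∑ i, |b.equivFun l i| ^ (1 / (k : ℝ)) * ccNorm (γ i)
  have hk' : 0 < 1 / (k : ℝ) := by positivity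
  have hF : Continuous F := by
    have h1 : Continuous b.equivFun :=
      LinearMap.continuous_of_finiteDimensional b.equivFun.toLinearMap
    refine continuous_finsetSum _ fun i _ => Continuous.mul ?_ continuous_const
    exact ((continuous_apply i).comp h1).abs.rpow_const fun _ => Or.inr hk'.le
  have hF0 : F 0 = 0 := by simp [F, hk]
  have hlift : ∀ l : levelSpace d N k hk, ∃ h : FreeNilpotent d N, HasLevel k h l ∧
      ccNorm h ≤ F l := by
    intro l
    have hs : ∀ s : Finset (Fin (Module.finrank ℝ (levelSpace d N k hk))),
        ∃ h : FreeNilpotent d N, HasLevel k h (∑ i ∈ s, b.equivFun l i • (b i : Word d N → ℝ)) ∧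
          ccNorm h ≤ ∑ i ∈ s, |b.equivFun l i| ^ (1 / (k : ℝ)) * ccNorm (γ i) := by
      intro s
      induction s using Finset.induction_on with
      | empty => exact ⟨1, by simpa using HasLevel.one k hk, by simp [ccNorm_one]⟩
      | insert i s hi ih =>
        obtain ⟨h, hh, hn⟩ := ih
        obtain ⟨h', hh', hn'⟩ := (hγ i).exists_smul hk (b.equivFun l i)
        refine ⟨h' * h, ?_, ?_⟩
        · rw [Finset.sum_insert hi]
          exact hh'.mul hk hh
        · rw [Finset.sum_insert hi]
          exact (ccNorm_mul_le _ _).trans (add_le_add hn' hn)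
    obtain ⟨h, hh, hn⟩ := hs Finset.univ
    refine ⟨h, ?_, hn⟩
    have : (l : Word d N → ℝ) = ∑ i, b.equivFun l i • (b i : Word d N → ℝ) := by
      have h1 := congrArg Subtype.val (b.sum_equivFun l)
      rw [Submodule.coe_sum] at h1
      exact h1.symm
    rwa [this]
  obtain ⟨δ, hδ, hball⟩ := Metric.continuous_iff.1 hF 0 ε hε
  refine ⟨δ, hδ, fun g l hg hl => ?_⟩
  obtain ⟨h, hh, hn⟩ := hlift ⟨l, g, hg⟩
  refine ⟨h, hh, hn.trans_lt ?_⟩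
  have hd : dist (⟨l, g, hg⟩ : levelSpace d N k hk) 0 < δ := by
    rw [dist_zero_right, Submodule.coe_norm, pi_norm_lt_iff hδ]
    exact hl
  have := hball _ hd
  rw [hF0, Real.dist_eq, sub_zero] at this
  exact (le_abs_self _).trans_lt this

/-- Induction on the number `m` of levels left, from the top level down. A short `h` with the
level-`k` component of `g` is split off; `h⁻¹ * g` then vanishes below `k + 1` and its coordinates
are still small, so the next level applies to it. -/
theorem ccNorm_lt_of_coord_lt_aux (m : ℕ) : ∀ k, k ≠ 0 → k + m = N + 1 → ∀ ε > 0, ∃ δ > 0,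
    ∀ g : FreeNilpotent d N, g.coord.VanishesBelow k → (∀ w, w.1 ≠ [] → |g.coord w| < δ) →
      ccNorm g < ε := by
  induction m with
  | zero =>
    intro k hk hkN ε hε
    refine ⟨1, one_pos, fun g hg _ => ?_⟩
    have : g = 1 := coord_injective (TruncTensor.ext fun w => by
      rw [coord_one, TruncTensor.one_apply]
      split_ifs with hw
      · exact coord_nil g w hw
      · exact hg w hw (by have := w.2; omega))
    rwa [this, ccNorm_one]
  | succ m ih =>
    intro k hk hkN ε hε
    obtain ⟨δ₁, hδ₁, h₁⟩ := ih (k + 1) (by omega) (by omega) (ε / 2) (half_pos hε)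
    -- `N + 1` is the product constant and `2 ^ N` bounds the coordinates of `h⁻¹`, whose norm is at
    -- most `1`. The bound `δ₁ / (4 * C)` keeps the coordinates of `h⁻¹ * g` below `δ₁`, and `ε / 2`
    -- is the share of `h`.
    set C : ℝ := (N + 1) * 2 ^ N with hC
    have hC0 : 0 < C := by positivity
    set η := min (min 1 (ε / 2)) (δ₁ / (4 * C)) with hη
    have hη0 : 0 < η := by positivity
    obtain ⟨δ₂, hδ₂, h₂⟩ := exists_hasLevel_ccNorm_lt (d := d) (N := N) hk hη0
    refine ⟨min η δ₂, lt_min hη0 hδ₂, fun g hg hgc => ?_⟩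
    obtain ⟨h, hh, hn⟩ := h₂ g (fun w => if w.1.length = k then g.coord w else 0)
      ⟨hg, fun _ => rfl⟩ (fun w => by
        split_ifs with hw
        · exact (hgc w (by rintro h; simp [h] at hw; omega)).trans_le (min_le_right _ _)
        · simpa using hδ₂)
    have hη1 : η ≤ 1 := (min_le_left _ _).trans (min_le_left _ _)
    have hη2 : η ≤ ε / 2 := (min_le_left _ _).trans (min_le_right _ _)
    have hη3 : η ≤ δ₁ / (4 * C) := min_le_right _ _
    have hlt := h₁ (h⁻¹ * g) (fun w hw hwk => by
      rw [coord_mul_of_vanishesBelow (vanishesBelow_inv hh.1) g w hw (by omega),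
        coord_inv_of_vanishesBelow hh.1 w hw (by omega)]
      by_cases hwk' : w.1.length = k
      · have := hh.2 w
        simp only [hwk', if_true] at this
        rw [this]
        ring
      · rw [hh.1 w hw (by omega), hg w hw (by omega)]
        ring) (fun w hw => by
      have hinv : ∀ w, |(h⁻¹).coord w| ≤ 2 ^ N := fun w => by
        have := abs_coord_le (g := h⁻¹) (R := 1) (by rw [ccNorm_inv]; linarith) w
        norm_num at this ⊢
        exact this
      have hsub : ∀ w, |g.coord w - h.coord w| ≤ 2 * η := fun w => by
        by_cases hw : w.1 = []
        · rw [coord_nil g w hw, coord_nil h w hw]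
          simp [hη0.le]
        · have e1 := (hgc w hw).trans_le (min_le_left _ _)
          have e2 := abs_coord_lt hη1 hn w hw
          exact (abs_sub _ _).trans (by linarith)
      -- Compare `h⁻¹ * g` with `h⁻¹ * h = 1`.
      have := TruncTensor.abs_mul_sub_mul_left_le (by positivity) (by positivity) hinv hsub w
      rw [← coord_mul, ← coord_mul, inv_mul_cancel, coord_one, TruncTensor.one_apply, if_neg hw,
        sub_zero] at this
      have h4 : η * (4 * C) ≤ δ₁ := (le_div_iff₀ (by positivity)).1 hη3
      have h5 : (N + 1) * (2 ^ N * (2 * η)) = η * (2 * C) := by rw [hC]; ring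
      have h6 : 0 < η * C := by positivity
      rw [h5] at this
      linarith)
    calc ccNorm g = ccNorm (h * (h⁻¹ * g)) := by rw [mul_inv_cancel_left]
      _ ≤ _ := ccNorm_mul_le _ _
      _ < ε := by linarith

/-- The Carnot-Carathéodory norm is small near the identity. -/
theorem exists_ccNorm_lt_of_coord_lt (d N : ℕ) {ε : ℝ} (hε : 0 < ε) : ∃ δ > 0,
    ∀ g : FreeNilpotent d N, (∀ w, w.1 ≠ [] → |g.coord w| < δ) → ccNorm g < ε := by
  obtain ⟨δ, hδ, h⟩ := ccNorm_lt_of_coord_lt_aux (d := d) N 1 one_ne_zero (add_comm 1 N) ε hε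
  exact ⟨δ, hδ, fun g hg => h g (fun w hw hk => absurd (by simpa using hk) hw) hg⟩

/-- Conjugation by elements of a ball is equicontinuous at the identity. -/
theorem exists_ccNorm_conj_lt (d N : ℕ) (R : ℝ) {ε : ℝ} (hε : 0 < ε) : ∃ δ > 0,
    ∀ g a : FreeNilpotent d N, ccNorm g ≤ R → ccNorm a < δ → ccNorm (g⁻¹ * a * g) < ε := by
  obtain ⟨δ, hδ, h⟩ := exists_ccNorm_lt_of_coord_lt d N hε
  set A : ℝ := (|R| + 1) ^ N with hA
  have hA0 : 0 < A := by positivity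
  -- The cost of the two multiplications that lead from `a - 1` to `g⁻¹ * a * g - g⁻¹ * 1 * g`.
  set C : ℝ := (N + 1) * ((N + 1) * (A * 1) * A) with hC
  have hC0 : 0 < C := by positivity
  set η := min 1 (δ / (2 * C)) with hη
  have hη0 : 0 < η := by positivity
  refine ⟨η, hη0, fun g a hg ha => h _ fun w hw => ?_⟩
  have b1 : ∀ w, |g.coord w| ≤ A := abs_coord_le (hg.trans (le_abs_self R))
  have b2 : ∀ w, |(g⁻¹).coord w| ≤ A :=
    abs_coord_le (by rw [ccNorm_inv]; exact hg.trans (le_abs_self R))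
  have b3 : ∀ w, |a.coord w - (1 : FreeNilpotent d N).coord w| ≤ η := fun w => by
    by_cases hw : w.1 = []
    · rw [coord_nil a w hw, coord_nil 1 w hw]
      simp [hη0.le]
    · rw [coord_one, TruncTensor.one_apply, if_neg hw, sub_zero]
      exact (abs_coord_lt (min_le_left _ _) ha w hw).le
  have b4 := TruncTensor.abs_mul_sub_mul_left_le hA0.le hη0.le b2 b3
  have b5 := TruncTensor.abs_mul_sub_mul_right_le hA0.le (by positivity) b1 b4 w
  rw [← coord_mul, ← coord_mul, ← coord_mul, ← coord_mul, mul_one, inv_mul_cancel, coord_one,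
    TruncTensor.one_apply, if_neg hw, sub_zero] at b5
  have h4 : η * (2 * C) ≤ δ := (le_div_iff₀ (by positivity)).1 (min_le_right _ _)
  have h5 : (N + 1) * ((N + 1) * (A * η) * A) = η * C := by rw [hC]; ring
  have h6 : 0 < η * C := by positivity
  rw [h5] at b5
  linarith

end FreeNilpotent

/-! ### Signature lifts and their stability in `L¹` -/

theorem abs_iterInt_le_pow {d : ℕ} {u : ℝ → EuclideanSpace ℝ (Fin d)}
    (hu : ∀ a b, IntervalIntegrable u volume a b) {s t L : ℝ} (hst : s ≤ t)
    (hL : ∫ r in s..t, ‖u r‖ ≤ L) (w : List (Fin d)) : |iterInt u t w s| ≤ L ^ w.length := by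
  have hL0 : 0 ≤ L := le_trans (intervalIntegral.integral_nonneg hst fun _ _ => norm_nonneg _) hL
  have key : ∀ r ∈ Set.Icc s t, |iterInt u t w r| ≤ L ^ w.length := by
    induction w with
    | nil => simp [iterInt]
    | cons i w ih =>
      intro r hr
      have h1 : |iterInt u t (i :: w) r| ≤ ∫ a in r..t, ‖u a‖ * L ^ w.length := by
        rw [← Real.norm_eq_abs, iterInt]
        refine intervalIntegral.norm_integral_le_of_norm_le hr.2
          (Eventually.of_forall fun a ha => ?_) ((hu _ _).norm.mul_const _)
        rw [norm_mul]
        exact mul_le_mul (PiLp.norm_apply_le (u a) i)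
          (ih a ⟨hr.1.trans ha.1.le, ha.2⟩) (norm_nonneg _) (norm_nonneg _)
      refine h1.trans ?_
      rw [intervalIntegral.integral_mul_const, List.length_cons, pow_succ']
      refine mul_le_mul_of_nonneg_right (le_trans ?_ hL) (pow_nonneg hL0 _)
      exact intervalIntegral.integral_mono_interval hr.1 hr.2 le_rfl
        (Eventually.of_forall fun _ => norm_nonneg _) (hu _ _).norm
  exact key s ⟨le_rfl, hst⟩

/-- Exchange one letter at a time: `u a - v b = (u - v) a + v (a - b)`, where `a`, `b` are the
integrals over the remaining letters. The assumption `1 ≤ L` lets the lower power of `L` be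
absorbed. -/
theorem abs_iterInt_sub_le {d : ℕ} {u v : ℝ → EuclideanSpace ℝ (Fin d)}
    (hu : ∀ a b, IntervalIntegrable u volume a b) (hv : ∀ a b, IntervalIntegrable v volume a b)
    {s t L D : ℝ} (hst : s ≤ t) (hL1 : 1 ≤ L) (hLu : ∫ r in s..t, ‖u r‖ ≤ L)
    (hLv : ∫ r in s..t, ‖v r‖ ≤ L) (hD : ∫ r in s..t, ‖u r - v r‖ ≤ D) (w : List (Fin d)) :
    |iterInt u t w s - iterInt v t w s| ≤ w.length * L ^ w.length * D := by
  have hD0 : 0 ≤ D := le_trans (intervalIntegral.integral_nonneg hst fun _ _ => norm_nonneg _) hD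
  have hmono : ∀ {f : ℝ → EuclideanSpace ℝ (Fin d)} (_ : ∀ a b, IntervalIntegrable f volume a b)
      {C : ℝ} (_ : ∫ r in s..t, ‖f r‖ ≤ C) {r : ℝ} (_ : r ∈ Set.Icc s t),
      ∫ a in r..t, ‖f a‖ ≤ C := fun hf _ hC _ hr =>
    (intervalIntegral.integral_mono_interval hr.1 hr.2 le_rfl
        (Eventually.of_forall fun _ => norm_nonneg _) (hf _ _).norm).trans hC
  have hdiff : ∀ a b, IntervalIntegrable (fun r => u r - v r) volume a b :=
    fun a b => (hu a b).sub (hv a b)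
  have key : ∀ r ∈ Set.Icc s t,
      |iterInt u t w r - iterInt v t w r| ≤ w.length * L ^ w.length * D := by
    induction w with
    | nil => simp [iterInt]
    | cons i w ih =>
      intro r hr
      have hI : ∀ (f : ℝ → EuclideanSpace ℝ (Fin d)) (_ : ∀ a b, IntervalIntegrable f volume a b),
          IntervalIntegrable (fun r => f r i * iterInt f t w r) volume r t :=
        fun f hf => (coord_integrable (hf _ _) i).mul_continuousOn
          (iterInt_continuous hf t w).continuousOn
      have h1 : |iterInt u t (i :: w) r - iterInt v t (i :: w) r| ≤
          ∫ a in r..t, (‖u a - v a‖ * L ^ w.length + ‖v a‖ * (w.length * L ^ w.length * D)) := by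
        rw [iterInt, iterInt, ← intervalIntegral.integral_sub (hI u hu) (hI v hv),
          ← Real.norm_eq_abs]
        refine intervalIntegral.norm_integral_le_of_norm_le hr.2
          (Eventually.of_forall fun a ha => ?_)
          (((hdiff _ _).norm.mul_const _).add ((hv _ _).norm.mul_const _))
        have ha' : a ∈ Set.Icc s t := ⟨hr.1.trans ha.1.le, ha.2⟩
        have e : u a i * iterInt u t w a - v a i * iterInt v t w a =
            (u a - v a) i * iterInt u t w a + v a i * (iterInt u t w a - iterInt v t w a) := by
          rw [PiLp.sub_apply]; ring
        rw [e]
        refine (norm_add_le _ _).trans (add_le_add ?_ ?_)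
        · rw [norm_mul]
          exact mul_le_mul (PiLp.norm_apply_le _ i)
            (abs_iterInt_le_pow hu ha'.2 (hmono hu hLu ha') w) (norm_nonneg _) (norm_nonneg _)
        · rw [norm_mul]
          exact mul_le_mul (PiLp.norm_apply_le _ i) (ih a ha') (norm_nonneg _) (norm_nonneg _)
      refine h1.trans ?_
      rw [intervalIntegral.integral_add ((hdiff _ _).norm.mul_const _)
        ((hv _ _).norm.mul_const _), intervalIntegral.integral_mul_const,
        intervalIntegral.integral_mul_const]
      have h2 := mul_le_mul_of_nonneg_right (hmono hdiff hD hr)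
        (pow_nonneg (zero_le_one.trans hL1) w.length)
      have h3 := mul_le_mul_of_nonneg_right (hmono hv hLv hr)
        (show 0 ≤ w.length * L ^ w.length * D by positivity)
      have h4 : D * L ^ w.length ≤ D * (L ^ w.length * L) :=
        mul_le_mul_of_nonneg_left (le_mul_of_one_le_right (by positivity) hL1) hD0
      push_cast [List.length_cons, pow_succ]
      linarith
  exact key s ⟨le_rfl, hst⟩

namespace FreeNilpotent
variable {d N : ℕ}

/-- Affine rescaling of `[s,t]` to `[0,1]`. The signature identity is also true for `t < s`; only
the length bound needs the order. -/
theorem exists_coord_eq_truncSig (N : ℕ) {u : ℝ → EuclideanSpace ℝ (Fin d)}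
    (hu : ∀ a b, IntervalIntegrable u volume a b) (s t : ℝ) :
    ∃ g : FreeNilpotent d N, g.coord = truncSig N u s t ∧
      (s ≤ t → ccNorm g ≤ ∫ r in s..t, ‖u r‖) := by
  have hv : IntervalIntegrable (fun r => (t - s) • u ((t - s) * r + s)) volume 0 1 := by
    rcases eq_or_ne (t - s) 0 with h | h
    · simp [h]
    · have := (((hu s t).comp_add_right s).comp_mul_left (c := t - s)).smul (t - s)
      rw [sub_self, zero_div, div_self h] at this
      exact this
  obtain ⟨g, hg⟩ := exists_coord_eq (N := N) hv
  refine ⟨g, ?_, fun hst => ?_⟩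
  · rw [hg]
    refine TruncTensor.ext fun w => ?_
    have := iterInt_affine u (t - s) s 0 1 w.1
    simpa [truncSig] using this
  · refine (ccNorm_le_of_path hv hg.symm).trans (le_of_eq ?_)
    have := intervalIntegral.smul_integral_comp_mul_add (a := 0) (b := 1)
      (fun r => ‖u r‖) (t - s) s
    simp only [mul_zero, zero_add, mul_one, sub_add_cancel] at this
    rw [← this, smul_eq_mul, ← intervalIntegral.integral_const_mul]
    simp [norm_smul, abs_of_nonneg (sub_nonneg.2 hst)]

/-- The step-`N` signature lift `t ↦ S_N(γ)_{0,t}` of the path `γ` with derivative `u`. -/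
noncomputable def sigLift (N : ℕ) {u : ℝ → EuclideanSpace ℝ (Fin d)}
    (hu : ∀ a b, IntervalIntegrable u volume a b) (t : ℝ) : FreeNilpotent d N :=
  (exists_coord_eq_truncSig N hu 0 t).choose

variable {u v : ℝ → EuclideanSpace ℝ (Fin d)} (hu : ∀ a b, IntervalIntegrable u volume a b)
  (hv : ∀ a b, IntervalIntegrable v volume a b)

theorem coord_sigLift (t : ℝ) : (sigLift N hu t).coord = truncSig N u 0 t :=
  (exists_coord_eq_truncSig N hu 0 t).choose_spec.1

theorem sigLift_zero : sigLift N hu 0 = 1 :=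
  coord_injective (by rw [coord_sigLift, truncSig_self, coord_one])

theorem sigLift_eq_mul {s t : ℝ} {g : FreeNilpotent d N} (hg : g.coord = truncSig N u s t) :
    sigLift N hu t = sigLift N hu s * g :=
  coord_injective (by
    rw [coord_mul, coord_sigLift, coord_sigLift, hg]
    exact TruncTensor.ext fun w => iterInt_chen_aux hu s t w.1 0)

theorem dist_sigLift_le {s t : ℝ} (hst : s ≤ t) :
    dist (sigLift N hu s) (sigLift N hu t) ≤ ∫ r in s..t, ‖u r‖ := by
  obtain ⟨g, hg, hl⟩ := exists_coord_eq_truncSig N hu s t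
  rw [dist_eq, sigLift_eq_mul hu hg, inv_mul_cancel_left]
  exact hl hst

theorem continuous_sigLift : Continuous (sigLift N hu) := by
  have h1 : ∀ s t, dist (sigLift N hu s) (sigLift N hu t) ≤ |∫ r in s..t, ‖u r‖| := by
    intro s t
    rcases le_total s t with h | h
    · exact (dist_sigLift_le hu h).trans (le_abs_self _)
    · rw [dist_comm, intervalIntegral.integral_symm, abs_neg]
      exact (dist_sigLift_le hu h).trans (le_abs_self _)
  rw [continuous_iff_continuousAt]
  intro s
  rw [ContinuousAt, tendsto_iff_dist_tendsto_zero]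
  have h2 : Continuous fun t => |∫ r in s..t, ‖u r‖| :=
    (intervalIntegral.continuous_primitive (fun a b => (hu a b).norm) s).abs
  have h3 := h2.tendsto s
  rw [intervalIntegral.integral_same, abs_zero] at h3
  exact squeeze_zero (fun _ => dist_nonneg) (fun t => by rw [dist_comm]; exact h1 s t) h3

/-- Signature lifts depend continuously, uniformly in time, on the derivative in `L¹`. -/
theorem exists_dist_sigLift_lt (N : ℕ) (T : ℝ) {ε : ℝ} (hε : 0 < ε) :
    ∃ δ > 0, ∀ (v : ℝ → EuclideanSpace ℝ (Fin d)) (hv : ∀ a b, IntervalIntegrable v volume a b),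
      ∫ r in (0 : ℝ)..T, ‖u r - v r‖ < δ → ∀ t ∈ Set.Icc 0 T,
        dist (sigLift N hu t) (sigLift N hv t) < ε := by
  obtain ⟨δ, hδ, h⟩ := exists_ccNorm_lt_of_coord_lt d N hε
  -- Bounds the lengths of `u` and of every `v` within `L¹`-distance `1`. The absolute value gives
  -- `1 ≤ L` for `T` of any sign.
  set L : ℝ := |∫ r in (0 : ℝ)..T, ‖u r‖| + 1 with hL
  have hL1 : 1 ≤ L := by have := abs_nonneg (∫ r in (0 : ℝ)..T, ‖u r‖); linarith
  set A : ℝ := (L + 1) ^ N with hA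
  have hA0 : 0 < A := by positivity
  -- The added `1` makes `C` positive and leaves a margin `η` that makes the final inequality
  -- strict.
  set C : ℝ := (N + 1) * (A * (N * L ^ N)) + 1 with hC
  have hC0 : 0 < C := by positivity
  set η := min 1 (δ / C) with hη
  have hη0 : 0 < η := by positivity
  refine ⟨η, hη0, fun v hv hD t ht => h _ fun w hw => ?_⟩
  have mono : ∀ {f : ℝ → EuclideanSpace ℝ (Fin d)} (_ : ∀ a b, IntervalIntegrable f volume a b),
      ∫ r in (0 : ℝ)..t, ‖f r‖ ≤ ∫ r in (0 : ℝ)..T, ‖f r‖ := fun hf =>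
    intervalIntegral.integral_mono_interval le_rfl ht.1 ht.2
      (Eventually.of_forall fun _ => norm_nonneg _) (hf _ _).norm
  have hT : 0 ≤ T := ht.1.trans ht.2
  have hLu : ∫ r in (0 : ℝ)..t, ‖u r‖ ≤ L :=
    (mono hu).trans ((le_abs_self _).trans (by linarith))
  have hDt : ∫ r in (0 : ℝ)..t, ‖u r - v r‖ ≤ η :=
    (mono fun a b => (hu a b).sub (hv a b)).trans hD.le
  have hLv : ∫ r in (0 : ℝ)..t, ‖v r‖ ≤ L := by
    have h1 : ∫ r in (0 : ℝ)..t, ‖v r‖ ≤ ∫ r in (0 : ℝ)..t, (‖u r‖ + ‖u r - v r‖) := by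
      refine intervalIntegral.integral_mono_on ht.1 (hv _ _).norm
        ((hu _ _).norm.add ((hu _ _).sub (hv _ _)).norm) fun r _ => ?_
      have := norm_sub_le (u r) (u r - v r)
      simpa using this
    rw [intervalIntegral.integral_add (hu _ _).norm ((hu _ _).sub (hv _ _)).norm] at h1
    have h2 : η ≤ 1 := min_le_left _ _
    have h3 := (mono hu).trans (le_abs_self _)
    linarith
  have hinv : ∀ w, |((sigLift N hu t)⁻¹).coord w| ≤ A := abs_coord_le (by
    rw [ccNorm_inv]
    have := dist_sigLift_le (N := N) hu ht.1
    rw [sigLift_zero, dist_eq, inv_one, one_mul] at this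
    exact this.trans hLu)
  have hsub : ∀ w, |(sigLift N hv t).coord w - (sigLift N hu t).coord w| ≤ N * L ^ N * η :=
    fun w => by
    rw [abs_sub_comm, coord_sigLift, coord_sigLift]
    refine (abs_iterInt_sub_le hu hv ht.1 hL1 hLu hLv hDt w.1).trans ?_
    refine mul_le_mul_of_nonneg_right ?_ hη0.le
    exact mul_le_mul (by exact_mod_cast w.2) (pow_le_pow_right₀ hL1 w.2) (by positivity)
      (by positivity)
  have := TruncTensor.abs_mul_sub_mul_left_le hA0.le (by positivity) hinv hsub w
  rw [← coord_mul, ← coord_mul, inv_mul_cancel, coord_one, TruncTensor.one_apply, if_neg hw,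
    sub_zero] at this
  have h4 : η * C ≤ δ := (le_div_iff₀ hC0).1 (min_le_right _ _)
  have h5 : (N + 1) * (A * (N * L ^ N * η)) = η * C - η := by rw [hC]; ring
  rw [h5] at this
  linarith

end FreeNilpotent

/-! ### Variation of functions of two times, and interpolation -/

section GeneralVariation
variable {T : ℝ}

/-- The `p`-variation over `[0,t]` of a function of two times. -/
noncomputable def biVar (p : ℝ) (f : Set.Icc (0 : ℝ) T → Set.Icc (0 : ℝ) T → ℝ≥0∞)
    (t : Set.Icc (0 : ℝ) T) : ℝ≥0∞ :=
  ⨆ D : Dissection t, (∑ i ∈ Finset.range D.1, f (D.2.1 i) (D.2.1 (i + 1)) ^ p) ^ (1 / p)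

variable {f g : Set.Icc (0 : ℝ) T → Set.Icc (0 : ℝ) T → ℝ≥0∞} {t : Set.Icc (0 : ℝ) T} {p q : ℝ}

theorem biVar_mono (hp : 0 ≤ p) (h : ∀ r s, r ≤ s → s ≤ t → f r s ≤ g r s) :
    biVar p f t ≤ biVar p g t := by
  refine iSup_mono fun D => ENNReal.rpow_le_rpow (Finset.sum_le_sum fun i _ => ?_) (by positivity)
  exact ENNReal.rpow_le_rpow (h _ _ (D.2.2.1 i.le_succ) (D.2.2.2 _)) hp

theorem biVar_add_le (hp : 1 ≤ p) :
    biVar p (fun r s => f r s + g r s) t ≤ biVar p f t + biVar p g t :=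
  iSup_le fun D => (ENNReal.Lp_add_le _ _ _ hp).trans
    (add_le_add (le_iSup_of_le D le_rfl) (le_iSup_of_le D le_rfl))

theorem sum_le_biVar_rpow (hp : 0 < p) (D : Dissection t) :
    ∑ i ∈ Finset.range D.1, f (D.2.1 i) (D.2.1 (i + 1)) ^ p ≤ biVar p f t ^ p := by
  have := ENNReal.rpow_le_rpow
    (le_iSup (fun D : Dissection t =>
      (∑ i ∈ Finset.range D.1, f (D.2.1 i) (D.2.1 (i + 1)) ^ p) ^ (1 / p)) D) hp.le
  rwa [← ENNReal.rpow_mul, one_div_mul_cancel hp.ne', ENNReal.rpow_one] at this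

theorem biVar_le_iff (hp : 0 < p) {C : ℝ≥0∞} : biVar p f t ≤ C ↔ ∀ D : Dissection t,
    ∑ i ∈ Finset.range D.1, f (D.2.1 i) (D.2.1 (i + 1)) ^ p ≤ C ^ p := by
  refine ⟨fun h D => (sum_le_biVar_rpow hp D).trans (ENNReal.rpow_le_rpow h hp.le), fun h =>
    iSup_le fun D => ?_⟩
  rw [one_div, ENNReal.rpow_inv_le_iff hp]
  exact h D

/-- Termwise `f^q = f^{q-p} f^p ≤ η^{q-p} f^p`. -/
theorem biVar_interpolation (hp : 0 < p) (hpq : p < q) {η : ℝ≥0∞}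
    (h : ∀ r s, r ≤ s → s ≤ t → f r s ≤ η) :
    biVar q f t ≤ (η ^ (q - p) * biVar p f t ^ p) ^ (1 / q) := by
  rw [biVar_le_iff (hp.trans hpq)]
  intro D
  rw [← ENNReal.rpow_mul, one_div_mul_cancel (hp.trans hpq).ne', ENNReal.rpow_one]
  refine le_trans ?_ (mul_le_mul_right (sum_le_biVar_rpow hp D) _)
  rw [Finset.mul_sum]
  refine Finset.sum_le_sum fun i _ => ?_
  have : q = (q - p) + p := by ring
  conv_lhs => rw [this, ENNReal.rpow_add_of_nonneg _ _ (sub_pos.2 hpq).le hp.le]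
  gcongr
  exact h _ _ (D.2.2.1 i.le_succ) (D.2.2.2 _)

theorem biVar_mono_time {s : Set.Icc (0 : ℝ) T} (h : s ≤ t) : biVar p f s ≤ biVar p f t :=
  iSup_le fun D => le_iSup_of_le (ι := Dissection t)
    (f := fun D => (∑ i ∈ Finset.range D.1, f (D.2.1 i) (D.2.1 (i + 1)) ^ p) ^ (1 / p))
    (⟨D.1, D.2.1, D.2.2.1, fun i => (D.2.2.2 i).trans h⟩ : Dissection t) le_rfl

theorem le_biVar (hp : 0 < p) {r s : Set.Icc (0 : ℝ) T} (hrs : r ≤ s) (hst : s ≤ t) :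
    f r s ≤ biVar p f t := by
  have := sum_le_biVar_rpow (f := f) hp (⟨1, fun i => if i = 0 then r else s, fun i j hij => by
    by_cases hj : j = 0
    · obtain rfl : i = 0 := by omega
      simp [hj]
    · by_cases hi : i = 0 <;> simp [hi, hj, hrs], fun i => by
    by_cases hi : i = 0 <;> simp [hi, hst, hrs.trans hst]⟩ : Dissection t)
  simpa [ENNReal.rpow_le_rpow_iff hp] using this

end GeneralVariation

section PVar
variable {E : Type*} [PseudoEMetricSpace E] {T : ℝ}

/-- With `f` the distance of values this is the `p`-variation; with `f` the distance between the
increments of two paths, `biVar` gives `pVarDist`. One set of estimates serves both. -/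
theorem pVarTo_eq_biVar (p : ℝ) (x : Set.Icc (0 : ℝ) T → E) (t : Set.Icc (0 : ℝ) T) :
    pVarTo p x t = biVar p (fun r s => edist (x r) (x s)) t := rfl

theorem pVarTo_mono_time (p : ℝ) (x : Set.Icc (0 : ℝ) T → E) {s t : Set.Icc (0 : ℝ) T}
    (h : s ≤ t) : pVarTo p x s ≤ pVarTo p x t := by
  rw [pVarTo_eq_biVar, pVarTo_eq_biVar]
  exact biVar_mono_time h

theorem pVarTo_le_pVar (p : ℝ) (x : Set.Icc (0 : ℝ) T → E) (t : Set.Icc (0 : ℝ) T) :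
    pVarTo p x t ≤ pVar p x := le_iSup (pVarTo p x) t

theorem pVar_le_iff {p : ℝ} (hp : 0 < p) {x : Set.Icc (0 : ℝ) T → E} {C : ℝ≥0∞} :
    pVar p x ≤ C ↔ ∀ (t : Set.Icc (0 : ℝ) T) (D : Dissection t),
      ∑ i ∈ Finset.range D.1, edist (x (D.2.1 i)) (x (D.2.1 (i + 1))) ^ p ≤ C ^ p := by
  rw [pVar, iSup_le_iff]
  simp only [pVarTo_eq_biVar, biVar_le_iff hp]

theorem edist_le_pVar {p : ℝ} (hp : 0 < p) (x : Set.Icc (0 : ℝ) T → E)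
    (r s : Set.Icc (0 : ℝ) T) : edist (x r) (x s) ≤ pVar p x := by
  rcases le_total r s with h | h
  · exact (le_biVar (f := fun r s => edist (x r) (x s)) hp h le_rfl).trans (pVarTo_le_pVar p x s)
  · rw [edist_comm]
    exact (le_biVar (f := fun r s => edist (x r) (x s)) hp h le_rfl).trans (pVarTo_le_pVar p x r)

/-- Interpolation with the `p`-variation itself as the bound on the increments. -/
theorem pVar_interpolation {p q : ℝ} (hp : 0 < p) (hpq : p < q) (x : Set.Icc (0 : ℝ) T → E) :
    pVar q x ≤ pVar p x := by
  refine iSup_le fun t => ?_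
  refine (biVar_interpolation hp hpq (η := pVar p x) fun r s _ _ =>
    edist_le_pVar hp x r s).trans ?_
  rw [one_div, ENNReal.rpow_inv_le_iff (hp.trans hpq)]
  calc _ ≤ pVar p x ^ (q - p) * pVar p x ^ p := by gcongr; exact pVarTo_le_pVar p x t
    _ = _ := by
      rw [← ENNReal.rpow_add_of_nonneg _ _ (sub_pos.2 hpq).le hp.le]
      simp

end PVar

/-! ### Uniform closeness and the `q`-variation metric -/

namespace FreeNilpotent
variable {d N : ℕ}

theorem edist_inv_mul_one (g h : FreeNilpotent d N) : edist (g⁻¹ * h) 1 = edist g h := by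
  rw [edist_dist, edist_dist, dist_comm, dist_eq, dist_eq, inv_one, one_mul]

end FreeNilpotent

section PVarDist
variable {d N : ℕ} {T : ℝ}

theorem pVarDist_one_right (p : ℝ) (x : Set.Icc (0 : ℝ) T → FreeNilpotent d N) :
    pVarDist p x (fun _ => 1) = pVar p x := by
  simp only [pVarDist, inv_one, mul_one, FreeNilpotent.edist_inv_mul_one]
  rfl

theorem pVarDist_comm (p : ℝ) (x y : Set.Icc (0 : ℝ) T → FreeNilpotent d N) :
    pVarDist p x y = pVarDist p y x := by
  simp only [pVarDist, edist_comm]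

theorem pVarDist_le_add {p : ℝ} (hp : 1 ≤ p) (x y : Set.Icc (0 : ℝ) T → FreeNilpotent d N) :
    pVarDist p x y ≤ pVar p x + pVar p y := by
  rw [← pVarDist_one_right, ← pVarDist_one_right, pVarDist_comm p y]
  exact pVarDist_triangle hp _ _ _

theorem pVarTo_le_add_pVarDist {p : ℝ} (hp : 1 ≤ p)
    (x y : Set.Icc (0 : ℝ) T → FreeNilpotent d N) (t : Set.Icc (0 : ℝ) T) :
    pVarTo p x t ≤ pVarTo p y t + pVarDist p x y := by
  rw [pVarTo_eq_biVar, pVarTo_eq_biVar]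
  refine (biVar_mono (g := fun r s => edist (y r) (y s) +
      edist ((x r)⁻¹ * x s) ((y r)⁻¹ * y s)) (zero_le_one.trans hp) fun r s _ _ => ?_).trans
    ((biVar_add_le hp).trans (add_le_add le_rfl ?_))
  · have := edist_triangle ((x r)⁻¹ * x s) ((y r)⁻¹ * y s) 1
    rwa [FreeNilpotent.edist_inv_mul_one, FreeNilpotent.edist_inv_mul_one, add_comm] at this
  · exact le_iSup (biVar p fun r s => edist ((x r)⁻¹ * x s) ((y r)⁻¹ * y s)) t

/-- The metric is only left-invariant, so moving the left end point perturbs the increment by a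
conjugate under `a⁻¹ * b`. The bound on `dist a b` is what makes that conjugation equicontinuous. -/
theorem exists_dist_increment_lt (d N : ℕ) (R : ℝ) {ε : ℝ} (hε : 0 < ε) : ∃ δ > 0,
    ∀ a b a' b' : FreeNilpotent d N, dist a b ≤ R → dist a a' < δ → dist b b' < δ →
      dist (a⁻¹ * b) (a'⁻¹ * b') < ε := by
  obtain ⟨δ, hδ, h⟩ := FreeNilpotent.exists_ccNorm_conj_lt d N R (half_pos hε)
  refine ⟨min δ (ε / 2), by positivity, fun a b a' b' hab ha hb => ?_⟩
  have e : (a⁻¹ * b)⁻¹ * (a'⁻¹ * b') = ((a⁻¹ * b)⁻¹ * (a'⁻¹ * a) * (a⁻¹ * b)) * (b⁻¹ * b') := by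
    group
  rw [FreeNilpotent.dist_eq, e]
  refine (FreeNilpotent.ccNorm_mul_le _ _).trans_lt ?_
  have h1 := h (a⁻¹ * b) (a'⁻¹ * a) hab (by
    rw [dist_comm] at ha
    exact ha.trans_le (min_le_left _ _))
  have h2 : FreeNilpotent.ccNorm (b⁻¹ * b') < ε / 2 := hb.trans_le (min_le_right _ _)
  linarith

theorem exists_pos_interpolation_lt {p q : ℝ} (hp : 0 < p) (hpq : p < q) {C ε : ℝ≥0∞}
    (hC : C ≠ ∞) (hε : 0 < ε) :
    ∃ η : ℝ, 0 < η ∧ (ENNReal.ofReal η ^ (q - p) * C) ^ (1 / q) < ε := by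
  have hq0 : 0 < q := hp.trans hpq
  have ht : Tendsto (fun η : ℝ≥0∞ => (η ^ (q - p) * C) ^ (1 / q)) (𝓝 0) (𝓝 0) := by
    have h1 : Tendsto (fun η : ℝ≥0∞ => η ^ (q - p) * C) (𝓝 0) (𝓝 0) := by
      have := ENNReal.Tendsto.mul_const
        ((ENNReal.continuous_rpow_const (y := q - p)).tendsto 0) (b := C) (Or.inr hC)
      rwa [ENNReal.zero_rpow_of_pos (sub_pos.2 hpq), zero_mul] at this
    have h2 := (ENNReal.continuous_rpow_const (y := 1 / q)).tendsto 0
    rw [ENNReal.zero_rpow_of_pos (by positivity)] at h2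
    exact h2.comp h1
  obtain ⟨η₀, hη₀, hη⟩ := ENNReal.nhds_zero_basis.eventually_iff.1 (ht.eventually_lt_const hε)
  obtain ⟨η, hη1, hη2⟩ := ENNReal.lt_iff_exists_nnreal_btwn.1 hη₀
  refine ⟨η, by exact_mod_cast hη1, ?_⟩
  rw [ENNReal.ofReal_coe_nnreal]
  exact hη hη2

/-- Uniformly close paths of bounded `p`-variation are close in `q`-variation, `q > p`. -/
theorem exists_pVarDist_le {p q : ℝ} (hp : 1 ≤ p) (hpq : p < q) (R : ℝ) {ε : ℝ≥0∞} (hε : 0 < ε) :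
    ∃ δ > 0, ∀ x y : Set.Icc (0 : ℝ) T → FreeNilpotent d N, pVar p x ≤ ENNReal.ofReal R →
      pVar p y ≤ ENNReal.ofReal R → (∀ t, dist (x t) (y t) < δ) → pVarDist q x y ≤ ε := by
  have hp0 : 0 < p := zero_lt_one.trans_le hp
  have hq0 : 0 < q := hp0.trans hpq
  -- Bounds the `p`-th power of `pVarDist p x y`, by the triangle inequality through the constant
  -- path.
  set C : ℝ≥0∞ := (ENNReal.ofReal R + ENNReal.ofReal R) ^ p with hC
  have hCtop : C ≠ ∞ := by simp [hC, hp0.le]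
  obtain ⟨η, hηpos, hη⟩ := exists_pos_interpolation_lt hp0 hpq hCtop hε
  obtain ⟨δ, hδ, h⟩ := exists_dist_increment_lt d N R hηpos
  refine ⟨δ, hδ, fun x y hx hy hxy => ?_⟩
  refine le_trans ?_ hη.le
  refine iSup_le fun t => ?_
  refine (biVar_interpolation (f := fun r s => edist ((x r)⁻¹ * x s) ((y r)⁻¹ * y s))
    hp0 hpq (η := ENNReal.ofReal η) fun r s _ _ => ?_).trans ?_
  · rcases le_or_gt 0 R with hR | hR
    · have := h (x r) (x s) (y r) (y s) (by
        have := (edist_le_pVar hp0 x r s).trans hx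
        rwa [edist_dist, ENNReal.ofReal_le_ofReal_iff hR] at this) (hxy r) (hxy s)
      rw [edist_dist]
      exact ENNReal.ofReal_le_ofReal this.le
    -- For negative `R` the hypotheses force both paths to be constant.
    · have h0 : ENNReal.ofReal R = 0 := ENNReal.ofReal_of_nonpos hR.le
      rw [h0] at hx hy
      have e1 := (edist_le_pVar hp0 x r s).trans hx
      have e2 := (edist_le_pVar hp0 y r s).trans hy
      rw [nonpos_iff_eq_zero, edist_eq_zero] at e1 e2
      simp [e1, e2]
  · gcongr
    rw [hC]
    gcongr
    exact (le_iSup (biVar p fun r s => edist ((x r)⁻¹ * x s) ((y r)⁻¹ * y s)) t).trans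
      ((pVarDist_le_add hp x y).trans (add_le_add hx hy))

end PVarDist

/-! ### The `p`-variation as a control -/

section Control
variable {E : Type*} [PseudoMetricSpace E] {T : ℝ}

/-- Any dissection of `[0,r]` extends by the step from `r` to `s`. This partial superadditivity is
all that is used of the control property. -/
theorem edist_rpow_add_pVarTo_le {p : ℝ} (hp : 0 < p) (x : Set.Icc (0 : ℝ) T → E)
    {r s : Set.Icc (0 : ℝ) T} (hrs : r ≤ s) :
    pVarTo p x r ^ p + edist (x r) (x s) ^ p ≤ pVarTo p x s ^ p := by
  have ha : edist (x r) (x s) ^ p ≠ ∞ := ENNReal.rpow_ne_top_of_nonneg hp.le (edist_ne_top _ _)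
  have hle : edist (x r) (x s) ^ p ≤ pVarTo p x s ^ p :=
    ENNReal.rpow_le_rpow (le_biVar (f := fun r s => edist (x r) (x s)) hp hrs le_rfl) hp.le
  have key : pVarTo p x r ≤ (pVarTo p x s ^ p - edist (x r) (x s) ^ p) ^ (1 / p) := by
    rw [pVarTo_eq_biVar, biVar_le_iff hp]
    intro D
    rw [← ENNReal.rpow_mul, one_div_mul_cancel hp.ne', ENNReal.rpow_one]
    refine ENNReal.le_sub_of_add_le_right ha ?_
    -- Two intervals are added: from the last point of `D` to `r`, whose contribution is dropped,
    -- and from `r` to `s`.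
    let u : ℕ → Set.Icc (0 : ℝ) T := fun i => if i ≤ D.1 then D.2.1 i else
      if i = D.1 + 1 then r else s
    have hu : Monotone u := by
      refine monotone_nat_of_le_succ fun i => ?_
      rcases lt_trichotomy i D.1 with h | h | h
      · have h1 : i ≤ D.1 := h.le
        have h2 : i + 1 ≤ D.1 := h
        simp only [u, h1, h2, if_true]
        exact D.2.2.1 i.le_succ
      · simp only [u, h, le_refl, if_true, Nat.not_succ_le_self, if_false]
        exact D.2.2.2 _
      · have h1 : ¬ i ≤ D.1 := by omega
        have h2 : ¬ i + 1 ≤ D.1 := by omega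
        have h3 : ¬ i + 1 = D.1 + 1 := by omega
        simp only [u, h1, h2, h3, if_false]
        split_ifs
        · exact hrs
        · exact le_rfl
    have hus : ∀ i, u i ≤ s := fun i => by
      simp only [u]
      split_ifs
      · exact (D.2.2.2 _).trans hrs
      · exact hrs
      · exact le_rfl
    have h := sum_le_biVar_rpow (f := fun r s => edist (x r) (x s)) hp
      (⟨D.1 + 2, u, hu, hus⟩ : Dissection s)
    rw [pVarTo_eq_biVar]
    refine le_trans ?_ h
    have e1 : u (D.1 + 1) = r := by simp [u]
    have e2 : u (D.1 + 2) = s := by simp [u]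
    simp only [Finset.sum_range_succ _ (D.1 + 1), e1, e2, Finset.sum_range_succ _ D.1]
    refine add_le_add (le_add_right (Finset.sum_le_sum fun i hi => ?_)) le_rfl
    rw [Finset.mem_range] at hi
    have h1 : i ≤ D.1 := hi.le
    have h2 : i + 1 ≤ D.1 := hi
    simp only [u, h1, h2, if_true, le_refl]
  rw [one_div, ENNReal.le_rpow_inv_iff hp] at key
  exact (add_le_add key le_rfl).trans (tsub_add_cancel_of_le hle).le

/-- The control `t ↦ ‖x‖^p_{p-var;[0,t]}`. -/
noncomputable def pControl (p : ℝ) (x : Set.Icc (0 : ℝ) T → E) (t : Set.Icc (0 : ℝ) T) : ℝ :=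
  (pVarTo p x t ^ p).toReal

theorem dist_rpow_le_pControl_sub {p : ℝ} (hp : 0 < p) {x : Set.Icc (0 : ℝ) T → E}
    (hx : pVar p x < ∞) {r s : Set.Icc (0 : ℝ) T} (hrs : r ≤ s) :
    dist (x r) (x s) ^ p ≤ pControl p x s - pControl p x r := by
  have hfin : ∀ t, pVarTo p x t ^ p ≠ ∞ := fun t =>
    ENNReal.rpow_ne_top_of_nonneg hp.le ((pVarTo_le_pVar p x t).trans_lt hx).ne
  have h := ENNReal.toReal_mono (hfin s) (edist_rpow_add_pVarTo_le hp x hrs)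
  rw [ENNReal.toReal_add (hfin r) (ENNReal.rpow_ne_top_of_nonneg hp.le (edist_ne_top _ _)),
    ← ENNReal.toReal_rpow (edist _ _), edist_dist, ENNReal.toReal_ofReal dist_nonneg] at h
  simp only [pControl]
  linarith

theorem monotone_pControl {p : ℝ} (hp : 0 < p) {x : Set.Icc (0 : ℝ) T → E} (hx : pVar p x < ∞) :
    Monotone (pControl p x) := fun r s hrs => by
  have := dist_rpow_le_pControl_sub hp hx hrs
  have h2 : 0 ≤ dist (x r) (x s) ^ p := by positivity
  linarith

theorem dist_le_pControl_sub_rpow {p : ℝ} (hp : 0 < p) {x : Set.Icc (0 : ℝ) T → E}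
    (hx : pVar p x < ∞) {r s : Set.Icc (0 : ℝ) T} (hrs : r ≤ s) :
    dist (x r) (x s) ≤ (pControl p x s - pControl p x r) ^ (1 / p) := by
  have h := Real.rpow_le_rpow (by positivity) (dist_rpow_le_pControl_sub hp hx hrs)
    (show 0 ≤ 1 / p by positivity)
  rwa [← Real.rpow_mul dist_nonneg, mul_one_div_cancel hp.ne', Real.rpow_one] at h

/-- The `p`-th powers of the increments are at most `K^p` times those of `W`, and these telescope.
-/
theorem pVar_le_of_control {p : ℝ} (hp : 0 < p) {x : Set.Icc (0 : ℝ) T → E}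
    {W : Set.Icc (0 : ℝ) T → ℝ} {C K : ℝ} (hK : 0 ≤ K) (hW : Monotone W)
    (hC : ∀ r s, W s - W r ≤ C)
    (h : ∀ r s, r ≤ s → dist (x r) (x s) ≤ K * (W s - W r) ^ (1 / p)) :
    pVar p x ≤ ENNReal.ofReal (K * C ^ (1 / p)) := by
  refine iSup_le fun t => ?_
  have hC0 : 0 ≤ C := by simpa using hC t t
  rw [pVarTo_eq_biVar, biVar_le_iff hp]
  intro D
  have e : ∀ {a : ℝ}, 0 ≤ a → (K * a ^ (1 / p)) ^ p = K ^ p * a := fun {a} ha => by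
    rw [Real.mul_rpow hK (by positivity), ← Real.rpow_mul ha, one_div_mul_cancel hp.ne',
      Real.rpow_one]
  rw [ENNReal.ofReal_rpow_of_nonneg (by positivity) hp.le, e hC0]
  have h1 : ∀ i ∈ Finset.range D.1, edist (x (D.2.1 i)) (x (D.2.1 (i + 1))) ^ p ≤
      ENNReal.ofReal (K ^ p * (W (D.2.1 (i + 1)) - W (D.2.1 i))) := fun i _ => by
    have hm := D.2.2.1 i.le_succ
    rw [edist_dist, ENNReal.ofReal_rpow_of_nonneg dist_nonneg hp.le,
      ← e (sub_nonneg.2 (hW hm))]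
    exact ENNReal.ofReal_le_ofReal (Real.rpow_le_rpow dist_nonneg (h _ _ hm) hp.le)
  refine (Finset.sum_le_sum h1).trans ?_
  rw [← ENNReal.ofReal_sum_of_nonneg fun i _ => mul_nonneg (by positivity)
    (sub_nonneg.2 (hW (D.2.2.1 i.le_succ)))]
  refine ENNReal.ofReal_le_ofReal ?_
  rw [← Finset.mul_sum, Finset.sum_range_sub (fun i => W (D.2.1 i))]
  exact mul_le_mul_of_nonneg_left (hC _ _) (by positivity)

end Control

/-! ### Approximation of lifts by smooth lifts -/

section Lifts
variable {d : ℕ}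

/-- The signature lift as a path in `C_o([0,T], G^N)`. -/
noncomputable def sigPath (N : ℕ) (T : ℝ) {u : ℝ → EuclideanSpace ℝ (Fin d)}
    (hu : ∀ a b, IntervalIntegrable u volume a b) : BasedPath d N T :=
  ⟨⟨fun t => FreeNilpotent.sigLift N hu t,
    (FreeNilpotent.continuous_sigLift hu).comp continuous_subtype_val⟩, fun t ht => by
    change FreeNilpotent.sigLift N hu t = 1
    rw [ht, FreeNilpotent.sigLift_zero]⟩

theorem pVar_one_sigPath_le (N : ℕ) {T : ℝ} {u : ℝ → EuclideanSpace ℝ (Fin d)}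
    (hu : ∀ a b, IntervalIntegrable u volume a b) :
    pVar 1 (sigPath N T hu).1 ≤ ENNReal.ofReal (∫ r in (0 : ℝ)..T, ‖u r‖) := by
  have hsub : ∀ r s : Set.Icc (0 : ℝ) T, (∫ a in (0 : ℝ)..s, ‖u a‖) - (∫ a in (0 : ℝ)..r, ‖u a‖) =
      ∫ a in (r : ℝ)..s, ‖u a‖ := fun r s =>
    intervalIntegral.integral_interval_sub_left (hu _ _).norm (hu _ _).norm
  have h := pVar_le_of_control (x := (sigPath N T hu).1) (p := 1) one_pos
    (W := fun t => ∫ r in (0 : ℝ)..t, ‖u r‖) (C := ∫ r in (0 : ℝ)..T, ‖u r‖) (K := 1) zero_le_one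
    (fun r s hrs => by
      rw [← sub_nonneg, hsub]
      exact intervalIntegral.integral_nonneg hrs fun _ _ => norm_nonneg _)
    (fun r s => by
      have h1 : ∫ a in (0 : ℝ)..s, ‖u a‖ ≤ ∫ r in (0 : ℝ)..T, ‖u r‖ :=
        intervalIntegral.integral_mono_interval le_rfl s.2.1 s.2.2
          (Eventually.of_forall fun _ => norm_nonneg _) (hu _ _).norm
      have h2 : 0 ≤ ∫ a in (0 : ℝ)..r, ‖u a‖ :=
        intervalIntegral.integral_nonneg r.2.1 fun _ _ => norm_nonneg _
      linarith)
    (fun r s hrs => by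
      rw [hsub, one_mul, one_div_one, Real.rpow_one]
      exact FreeNilpotent.dist_sigLift_le hu hrs)
  simpa using h

/-- Reduces approximation in `q`-variation to uniform approximation under a `p`-variation bound. It
serves with `p = 1` for smoothing lifts and with general `p` for piecewise almost geodesics. -/
theorem mem_closure_of_uniform_approx {N : ℕ} {T p q : ℝ} (hp : 1 ≤ p) (hpq : p < q) {hq : 1 ≤ q}
    {S : Set (PVarPath d N T q hq)} {x : PVarPath d N T q hq} {R : ℝ}
    (hx : pVar p x.1.1 ≤ ENNReal.ofReal R)
    (h : ∀ δ > 0, ∃ y ∈ S, pVar p y.1.1 ≤ ENNReal.ofReal R ∧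
      ∀ t, dist (x.1.1 t) (y.1.1 t) < δ) : x ∈ closure S := by
  rw [EMetric.mem_closure_iff]
  intro ε hε
  obtain ⟨ε', hε', hεε'⟩ := exists_between hε
  obtain ⟨δ, hδ, hd⟩ := exists_pVarDist_le (d := d) (N := N) (T := T) hp hpq R hε'
  obtain ⟨y, hy, hyR, hxy⟩ := h δ hδ
  exact ⟨y, hy, (hd _ _ hx hyR hxy).trans_lt hεε'⟩

theorem exists_smooth_integral_norm_sub_lt {T : ℝ} (hT : 0 ≤ T) {u : ℝ → EuclideanSpace ℝ (Fin d)}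
    (hu : ∀ a b, IntervalIntegrable u volume a b) {δ : ℝ} (hδ : 0 < δ) :
    ∃ g : ℝ → EuclideanSpace ℝ (Fin d), ContDiff ℝ ((⊤ : ℕ∞) : WithTop ℕ∞) g ∧
      ∫ r in (0 : ℝ)..T, ‖u r - g r‖ < δ := by
  have hi : Integrable ((Set.Ioc (0 : ℝ) T).indicator u) := by
    rw [integrable_indicator_iff measurableSet_Ioc]
    exact (intervalIntegrable_iff_integrableOn_Ioc_of_le hT).1 (hu 0 T)
  obtain ⟨g, hgc, hg, hgn⟩ := (memLp_one_iff_integrable.2 hi).exist_eLpNorm_sub_le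
    ENNReal.one_ne_top le_rfl (half_pos hδ)
  have hgi : Integrable g := hg.continuous.integrable_of_hasCompactSupport hgc
  refine ⟨g, hg, lt_of_le_of_lt ?_ (half_lt_self hδ)⟩
  have h1 : ∫ r, ‖(Set.Ioc (0 : ℝ) T).indicator u r - g r‖ ≤ δ / 2 := by
    rw [eLpNorm_one_eq_lintegral_enorm] at hgn
    refine (integral_norm_eq_lintegral_enorm (hi.sub hgi).aestronglyMeasurable).trans_le ?_
    exact ENNReal.toReal_le_of_le_ofReal (half_pos hδ).le hgn
  refine le_trans ?_ h1
  rw [intervalIntegral.integral_of_le hT]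
  rw [setIntegral_congr_fun (g := fun r => ‖(Set.Ioc (0 : ℝ) T).indicator u r - g r‖)
    measurableSet_Ioc fun r hr => by simp only [Set.indicator_of_mem hr]]
  exact setIntegral_le_integral (hi.sub hgi).norm (Eventually.of_forall fun _ => norm_nonneg _)

/-- Smooth `L¹` approximations of the derivative have bounded length and uniformly close lifts, so
interpolation between `1` and `q` applies; hence `1 < q`. -/
theorem sigPath_mem_closure_smoothLifts {N : ℕ} {T q : ℝ} (hT : 0 ≤ T) (hq : 1 < q)
    {u : ℝ → EuclideanSpace ℝ (Fin d)} (hu : ∀ a b, IntervalIntegrable u volume a b)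
    (hfin : pVar q (sigPath N T hu).1 < ∞) :
    (⟨sigPath N T hu, hfin⟩ : PVarPath d N T q hq.le) ∈ closure (smoothLifts d N T q hq.le) := by
  have hU := pVar_one_sigPath_le (T := T) N hu
  refine mem_closure_of_uniform_approx le_rfl hq (R := (∫ r in (0 : ℝ)..T, ‖u r‖) + 1)
    (hU.trans (ENNReal.ofReal_le_ofReal (by linarith))) fun δ hδ => ?_
  obtain ⟨η, hη, hclose⟩ := FreeNilpotent.exists_dist_sigLift_lt hu N T hδ
  obtain ⟨g, hg, hgn⟩ := exists_smooth_integral_norm_sub_lt hT hu (lt_min one_pos hη)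
  have hgi : ∀ a b, IntervalIntegrable g volume a b := fun a b =>
    hg.continuous.intervalIntegrable a b
  have hV := pVar_one_sigPath_le (T := T) N hgi
  have hgu : ∫ r in (0 : ℝ)..T, ‖g r‖ ≤ (∫ r in (0 : ℝ)..T, ‖u r‖) + 1 := by
    have h1 : ∫ r in (0 : ℝ)..T, ‖g r‖ ≤ ∫ r in (0 : ℝ)..T, (‖u r‖ + ‖u r - g r‖) := by
      refine intervalIntegral.integral_mono_on hT (hgi _ _).norm
        ((hu _ _).norm.add ((hu _ _).sub (hgi _ _)).norm) fun r _ => ?_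
      have := norm_sub_le (u r) (u r - g r)
      simpa using this
    rw [intervalIntegral.integral_add (hu _ _).norm ((hu _ _).sub (hgi _ _)).norm] at h1
    have := hgn.trans_le (min_le_left _ _)
    linarith
  refine ⟨⟨sigPath N T hgi, ((pVar_interpolation one_pos hq _).trans hV).trans_lt
    ENNReal.ofReal_lt_top⟩, ?_, hV.trans (ENNReal.ofReal_le_ofReal hgu), fun t =>
    hclose g hgi (hgn.trans_le (min_le_right _ _)) t t.2⟩
  have hd : ∀ t, HasDerivAt (fun t => ∫ r in (0 : ℝ)..t, g r) (g t) t := fun t =>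
    intervalIntegral.integral_hasDerivAt_right (hgi _ _)
      (hg.continuous.stronglyMeasurableAtFilter _ _) hg.continuous.continuousAt
  have hder : deriv (fun t => ∫ r in (0 : ℝ)..t, g r) = g := funext fun t => (hd t).deriv
  refine ⟨fun t => ∫ r in (0 : ℝ)..t, g r, ?_, by simp, fun t => ?_⟩
  · rw [contDiff_infty_iff_deriv, hder]
    exact ⟨fun t => (hd t).differentiableAt, hg⟩
  · rw [hder]
    exact FreeNilpotent.coord_sigLift hgi t

end Lifts

/-! ### Almost geodesic interpolation -/

namespace FreeNilpotent
variable {d N : ℕ}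

/-- A path from `1` to `g` of length at most twice the minimum, with its progress `θ`. -/
theorem exists_almost_geodesic (g : FreeNilpotent d N) :
    ∃ (v : ℝ → EuclideanSpace ℝ (Fin d)) (θ : ℝ → ℝ), Integrable v ∧ Monotone θ ∧
      (∀ r ≤ 0, θ r = 0) ∧ (∀ r, 1 ≤ r → θ r = 1) ∧ truncSig N v 0 1 = g.coord ∧
      ∀ s t, s ≤ t → ∫ r in s..t, ‖v r‖ ≤ 2 * ccNorm g * (θ t - θ s) := by
  rcases eq_or_ne g 1 with rfl | hg
  · refine ⟨fun _ => 0, fun r => max 0 (min 1 r), integrable_zero _ _ _, ?_, ?_, ?_, ?_, ?_⟩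
    · exact fun r s h => max_le_max le_rfl (min_le_min le_rfl h)
    · exact fun r hr => max_eq_left ((min_le_right _ _).trans hr)
    · intro r hr
      simp only [min_eq_left hr, max_eq_right zero_le_one]
    · refine TruncTensor.ext fun w => ?_
      obtain ⟨w, hw⟩ := w
      cases w <;> simp [truncSig, iterInt, TruncTensor.one_apply, coord_one]
    · simp [ccNorm_one]
  -- No minimiser is needed: for `g ≠ 1` some path is shorter than twice the norm. Its derivative is
  -- extended by `0` outside `[0,1]`, and `θ` is its normalised arc length.
  · have hpos : 0 < ccNorm g := (ccNorm_nonneg g).lt_of_ne fun h =>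
      hg (eq_one_of_ccNorm_eq_zero g h.symm)
    obtain ⟨u, hu, hug, hl⟩ := exists_length_lt (show ccNorm g < 2 * ccNorm g by linarith)
    have hge := ccNorm_le_of_path hu hug
    set v : ℝ → EuclideanSpace ℝ (Fin d) := (Set.Ioc (0 : ℝ) 1).indicator u with hv
    have hvi : Integrable v := by
      rw [hv, integrable_indicator_iff measurableSet_Ioc]
      exact (intervalIntegrable_iff_integrableOn_Ioc_of_le zero_le_one).1 hu
    have hvI : ∀ a b, IntervalIntegrable (fun r => ‖v r‖) volume a b :=
      fun a b => hvi.norm.intervalIntegrable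
    have huv : ∀ r ∈ Set.Ioc (0 : ℝ) 1, v r = u r := fun r hr => Set.indicator_of_mem hr u
    have hlen : ∫ r in (0 : ℝ)..1, ‖v r‖ = ∫ r in (0 : ℝ)..1, ‖u r‖ :=
      intervalIntegral.integral_congr_ae (Eventually.of_forall fun r hr => by
        rw [Set.uIoc_of_le zero_le_one] at hr
        rw [huv r hr])
    set L := ∫ r in (0 : ℝ)..1, ‖u r‖ with hL
    have hL0 : 0 < L := hpos.trans_le hge
    have hsub : ∀ s t, (∫ r in (0 : ℝ)..t, ‖v r‖) / L - (∫ r in (0 : ℝ)..s, ‖v r‖) / L =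
        (∫ r in s..t, ‖v r‖) / L := fun s t => by
      rw [← sub_div, intervalIntegral.integral_interval_sub_left (hvI _ _) (hvI _ _)]
    refine ⟨v, fun r => (∫ a in (0 : ℝ)..r, ‖v a‖) / L, hvi, ?_, ?_, ?_, ?_, ?_⟩
    · intro s t hst
      have : 0 ≤ (∫ r in s..t, ‖v r‖) / L :=
        div_nonneg (intervalIntegral.integral_nonneg hst fun _ _ => norm_nonneg _) hL0.le
      rw [← hsub] at this
      exact sub_nonneg.1 this
    · intro r hr
      have : ∫ a in (0 : ℝ)..r, ‖v a‖ = ∫ a in (0 : ℝ)..r, (0 : ℝ) :=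
        intervalIntegral.integral_congr_ae (Eventually.of_forall fun a ha => by
          rw [Set.uIoc_of_ge hr] at ha
          rw [hv, Set.indicator_of_notMem (fun h => absurd ha.2 (not_le.2 h.1)), norm_zero])
      simp only [this, intervalIntegral.integral_zero, zero_div]
    · intro r hr
      have : ∫ a in (1 : ℝ)..r, ‖v a‖ = ∫ a in (1 : ℝ)..r, (0 : ℝ) :=
        intervalIntegral.integral_congr_ae (Eventually.of_forall fun a ha => by
          rw [Set.uIoc_of_le hr] at ha
          rw [hv, Set.indicator_of_notMem (fun h => absurd h.2 (not_le.2 ha.1)), norm_zero])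
      simp only
      rw [← intervalIntegral.integral_add_adjacent_intervals (hvI 0 1) (hvI 1 r), this, hlen,
        intervalIntegral.integral_zero, add_zero, div_self hL0.ne']
    · rw [← hug]
      exact TruncTensor.ext fun w =>
        iterInt_congr huv w.1 (by norm_num) (by norm_num)
    · intro s t hst
      simp only [hsub]
      have h1 : 0 ≤ ∫ r in s..t, ‖v r‖ :=
        intervalIntegral.integral_nonneg hst fun _ _ => norm_nonneg _
      rw [mul_div_assoc', le_div_iff₀ hL0, mul_comm]
      exact mul_le_mul_of_nonneg_right hl.le h1

end FreeNilpotent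

theorem exists_index_mem_Icc {h t : ℝ} (hh : 0 < h) {n : ℕ} (hn : n ≠ 0) (ht0 : 0 ≤ t)
    (ht : t ≤ n * h) : ∃ j < n, (j : ℝ) * h ≤ t ∧ t ≤ (j + 1 : ℝ) * h := by
  have h1 : t / h ≤ n := (div_le_iff₀ hh).2 ht
  rcases h1.eq_or_lt with h2 | h2
  -- The end point `n * h` is assigned to the last cell.
  · refine ⟨n - 1, by omega, ?_, ?_⟩
    · rw [← le_div_iff₀ hh, h2]
      exact_mod_cast Nat.sub_le n 1
    · rw [← div_le_iff₀ hh, h2]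
      exact_mod_cast (by omega : n ≤ n - 1 + 1)
  · refine ⟨⌊t / h⌋₊, (Nat.floor_lt (by positivity)).2 h2, ?_, ?_⟩
    · rw [← le_div_iff₀ hh]
      exact Nat.floor_le (by positivity)
    · rw [← div_le_iff₀ hh]
      exact (Nat.lt_floor_add_one _).le

/-- Piecewise almost geodesic interpolation on a grid of mesh `h` of a path controlled by `V`. -/
theorem exists_piecewise_almost_geodesic {d N : ℕ} {p : ℝ} (hp : 1 ≤ p)
    (x : ℝ → FreeNilpotent d N) (V : ℝ → ℝ) (hV : Monotone V) (hx0 : x 0 = 1)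
    (hx : ∀ s t, s ≤ t → dist (x s) (x t) ≤ (V t - V s) ^ (1 / p)) {h : ℝ} (hh : 0 < h) {n : ℕ}
    (hn : n ≠ 0) :
    ∃ (u : ℝ → EuclideanSpace ℝ (Fin d)) (hu : ∀ a b, IntervalIntegrable u volume a b)
      (W : ℝ → ℝ), Monotone W ∧ W (n * h) - W 0 = V (n * h) - V 0 ∧
      (∀ s t, 0 ≤ s → s ≤ t → t ≤ n * h →
        dist (FreeNilpotent.sigLift N hu s) (FreeNilpotent.sigLift N hu t) ≤
          6 * (W t - W s) ^ (1 / p)) ∧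
      ∀ j < n, ∀ t, j * h ≤ t → t ≤ (j + 1) * h →
        dist (FreeNilpotent.sigLift N hu t) (x t) ≤
          2 * dist (x (j * h)) (x ((j + 1) * h)) + dist (x (j * h)) (x t) := by
  have hp0 : 0 < p := zero_lt_one.trans_le hp
  have hgeo := fun i : ℕ =>
    FreeNilpotent.exists_almost_geodesic ((x (i * h))⁻¹ * x ((i + 1) * h))
  choose v θ hvi hθ hθ0 hθ1 hvs hvl using hgeo
  let u : ℝ → EuclideanSpace ℝ (Fin d) := fun r =>
    ∑ i ∈ Finset.range n, (Set.Ioc ((i : ℝ) * h) ((i + 1) * h)).indicator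
      (fun r => h⁻¹ • v i (h⁻¹ * r + -(i : ℝ))) r
  -- Redistributes the growth of `V` inside each cell according to the progress of the path there;
  -- on the grid `W` agrees with `V - V 0`.
  let W : ℝ → ℝ := fun r =>
    ∑ i ∈ Finset.range n, (V ((i + 1) * h) - V (i * h)) * θ i (h⁻¹ * r + -(i : ℝ))
  have hui : Integrable u := by
    refine integrable_finsetSum _ fun i _ => Integrable.indicator ?_ measurableSet_Ioc
    exact ((((hvi i).comp_add_right (-(i : ℝ))).comp_mul_left' (inv_ne_zero hh.ne'))).smul h⁻¹
  have hu : ∀ a b, IntervalIntegrable u volume a b := fun a b => hui.intervalIntegrable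
  have huj : ∀ j < n, ∀ r ∈ Set.Ioc ((j : ℝ) * h) ((j + 1) * h),
      u r = h⁻¹ • v j (h⁻¹ * r + -(j : ℝ)) := fun j hj r hr => by
    simp only [u]
    rw [Finset.sum_eq_single_of_mem j (Finset.mem_range.2 hj), Set.indicator_of_mem hr]
    intro i _ hij
    refine Set.indicator_of_notMem (fun hi => hij ?_) _
    have h1 : (i : ℝ) * h < (j + 1) * h := hi.1.trans_le hr.2
    have h2 : (j : ℝ) * h < (i + 1) * h := hr.1.trans_le hi.2
    have h3 : (i : ℝ) < j + 1 := lt_of_mul_lt_mul_right h1 hh.le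
    have h4 : (j : ℝ) < i + 1 := lt_of_mul_lt_mul_right h2 hh.le
    have h5 : i < j + 1 := by exact_mod_cast h3
    have h6 : j < i + 1 := by exact_mod_cast h4
    omega
  have hstep : ∀ i : ℕ, (i : ℝ) * h ≤ (i + 1) * h := fun i => by nlinarith
  have hW : Monotone W := fun r s hrs => Finset.sum_le_sum fun i _ =>
    mul_le_mul_of_nonneg_left (hθ i (by have := inv_pos.2 hh; gcongr))
      (sub_nonneg.2 (hV (hstep i)))
  have hgrid : ∀ j, j ≤ n → FreeNilpotent.sigLift N hu (j * h) = x (j * h) := by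
    intro j
    induction j with
    | zero => simp [FreeNilpotent.sigLift_zero, hx0]
    | succ j ih =>
      intro hj
      have hseg : ((x (j * h))⁻¹ * x ((j + 1) * h)).coord =
          truncSig N u (j * h) ((j + 1) * h) := by
        rw [← hvs j]
        refine TruncTensor.ext fun w => ?_
        have e := iterInt_affine (v j) h⁻¹ (-(j : ℝ)) (j * h) ((j + 1) * h) w.1
        have e1 : h⁻¹ * ((j : ℝ) * h) + -(j : ℝ) = 0 := by field_simp; ring
        have e2 : h⁻¹ * (((j : ℝ) + 1) * h) + -(j : ℝ) = 1 := by field_simp; ring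
        rw [e1, e2] at e
        simp only [truncSig]
        rw [← e]
        exact (iterInt_congr (huj j (by omega)) w.1 ⟨le_rfl, hstep j⟩ ⟨hstep j, le_rfl⟩).symm
      push_cast
      rw [FreeNilpotent.sigLift_eq_mul hu hseg, ih (by omega), mul_inv_cancel_left]
  have hlocal : ∀ j < n, ∀ s t, j * h ≤ s → s ≤ t → t ≤ (j + 1) * h →
      dist (FreeNilpotent.sigLift N hu s) (FreeNilpotent.sigLift N hu t) ≤
        2 * dist (x (j * h)) (x ((j + 1) * h)) *
          (θ j (h⁻¹ * t + -(j : ℝ)) - θ j (h⁻¹ * s + -(j : ℝ))) := by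
    intro j hj s t hs hst ht
    have hst' : h⁻¹ * s + -(j : ℝ) ≤ h⁻¹ * t + -(j : ℝ) := by
      have := inv_pos.2 hh
      gcongr
    refine (FreeNilpotent.dist_sigLift_le hu hst).trans (le_trans (le_of_eq ?_)
      (hvl j _ _ hst'))
    rw [← intervalIntegral.smul_integral_comp_mul_add, smul_eq_mul,
      ← intervalIntegral.integral_const_mul]
    refine intervalIntegral.integral_congr_ae (Eventually.of_forall fun r hr => ?_)
    rw [Set.uIoc_of_le hst] at hr
    rw [huj j hj r ⟨hs.trans_lt hr.1, hr.2.trans ht⟩, norm_smul, Real.norm_eq_abs,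
      abs_of_pos (inv_pos.2 hh)]
  have hθle : ∀ j r s, θ j s - θ j r ≤ 1 := fun j r s => by
    have h1 : θ j s ≤ 1 := (hθ j (le_max_left s 1)).trans (hθ1 j _ (le_max_right s 1)).le
    have h2 : 0 ≤ θ j r := (hθ0 j _ (min_le_right r 0)).ge.trans (hθ j (min_le_left r 0))
    linarith
  have hlocalW : ∀ j < n, ∀ s t, j * h ≤ s → s ≤ t → t ≤ (j + 1) * h →
      dist (FreeNilpotent.sigLift N hu s) (FreeNilpotent.sigLift N hu t) ≤
        2 * (W t - W s) ^ (1 / p) := by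
    intro j hj s t hs hst ht
    have hst' : h⁻¹ * s + -(j : ℝ) ≤ h⁻¹ * t + -(j : ℝ) := by
      have := inv_pos.2 hh
      gcongr
    set Δ := θ j (h⁻¹ * t + -(j : ℝ)) - θ j (h⁻¹ * s + -(j : ℝ)) with hΔ
    have hΔ0 : 0 ≤ Δ := sub_nonneg.2 (hθ j hst')
    have hΔ1 : Δ ≤ 1 := hθle j _ _
    have hVj : 0 ≤ V ((j + 1) * h) - V (j * h) := sub_nonneg.2 (hV (hstep j))
    have hWst : (V ((j + 1) * h) - V (j * h)) * Δ ≤ W t - W s := by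
      simp only [W, ← Finset.sum_sub_distrib, ← mul_sub]
      refine Finset.single_le_sum (f := fun i : ℕ => (V ((i + 1) * h) - V (i * h)) *
        (θ i (h⁻¹ * t + -(i : ℝ)) - θ i (h⁻¹ * s + -(i : ℝ)))) (fun i _ => ?_)
        (Finset.mem_range.2 hj)
      refine mul_nonneg (sub_nonneg.2 (hV (hstep i))) (sub_nonneg.2 (hθ i ?_))
      have := inv_pos.2 hh
      gcongr
    refine (hlocal j hj s t hs hst ht).trans ?_
    rw [mul_assoc]
    refine mul_le_mul_of_nonneg_left ?_ zero_le_two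
    -- Since `0 ≤ Δ ≤ 1` and `p ≥ 1`, `Δ ≤ Δ^{1/p}`; progress linear in `Δ` thus fits the control
    -- bound.
    calc dist (x (j * h)) (x ((j + 1) * h)) * Δ
        ≤ (V ((j + 1) * h) - V (j * h)) ^ (1 / p) * Δ ^ (1 / p) := by
          refine mul_le_mul (hx _ _ (hstep j)) ?_ hΔ0 (by positivity)
          have := Real.rpow_le_rpow_of_exponent_ge' hΔ0 hΔ1 (show 0 ≤ 1 / p by positivity)
            ((div_le_one hp0).2 hp)
          rwa [Real.rpow_one] at this
      _ = ((V ((j + 1) * h) - V (j * h)) * Δ) ^ (1 / p) := (Real.mul_rpow hVj hΔ0).symm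
      _ ≤ (W t - W s) ^ (1 / p) := Real.rpow_le_rpow (by positivity) hWst (by positivity)
  have hWgrid : ∀ j, j ≤ n → W (j * h) = V (j * h) - V 0 := by
    intro j hj
    obtain ⟨m, rfl⟩ := Nat.exists_eq_add_of_le hj
    have e : ∀ i : ℕ, h⁻¹ * ((j : ℝ) * h) + -(i : ℝ) = j - i := fun i => by
      field_simp; ring
    simp only [W, e, Finset.sum_range_add]
    rw [Finset.sum_eq_zero (s := Finset.range m), add_zero]
    · have h1 : ∀ i ∈ Finset.range j, (V ((i + 1) * h) - V (i * h)) * θ i ((j : ℝ) - i) =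
          V (((i + 1 : ℕ) : ℝ) * h) - V (i * h) := fun i hi => by
        rw [hθ1, mul_one]
        · push_cast; rfl
        · have : i + 1 ≤ j := Finset.mem_range.1 hi
          have : (i : ℝ) + 1 ≤ j := by exact_mod_cast this
          linarith
      rw [Finset.sum_congr rfl h1, Finset.sum_range_sub (fun i : ℕ => V ((i : ℝ) * h))]
      simp
    · intro i _
      rw [hθ0, mul_zero]
      push_cast
      have : (0 : ℝ) ≤ i := by positivity
      linarith
  refine ⟨u, hu, W, hW, ?_, ?_, ?_⟩
  · have := hWgrid 0 (by omega)
    rw [Nat.cast_zero, zero_mul] at this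
    rw [hWgrid n le_rfl, this]
    ring
  · intro s t hs hst ht
    have hle : ∀ {a b : ℝ}, a ≤ b → s ≤ a → b ≤ t →
        (W b - W a) ^ (1 / p) ≤ (W t - W s) ^ (1 / p) := fun hab ha hb =>
      Real.rpow_le_rpow (sub_nonneg.2 (hW hab)) (sub_le_sub (hW hb) (hW ha)) (by positivity)
    have h0 : 0 ≤ (W t - W s) ^ (1 / p) := Real.rpow_nonneg (sub_nonneg.2 (hW hst)) _
    obtain ⟨i, hi, hi1, hi2⟩ := exists_index_mem_Icc hh hn hs (hst.trans ht)
    obtain ⟨j, hj, hj1, hj2⟩ := exists_index_mem_Icc hh hn (hs.trans hst) ht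
    rcases lt_trichotomy i j with hij | rfl | hij
    -- Split at the grid points next to `s` and `t`: two partial cells cost `2` each and the middle
    -- part costs `1`, in total at most `6`.
    · have hij' : ((i : ℝ) + 1) * h ≤ j * h := by
        have : (i : ℝ) + 1 ≤ j := by exact_mod_cast hij
        gcongr
      have d1 := hlocalW i hi s _ hi1 hi2 le_rfl
      have d3 := hlocalW j hj _ t le_rfl hj1 hj2
      have d2 := hx _ _ hij'
      have e1 := hgrid (i + 1) (by omega)
      have e2 := hgrid j hj.le
      have e3 := hWgrid (i + 1) (by omega)
      have e4 := hWgrid j hj.le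
      push_cast at e1 e3
      rw [← e1, ← e2] at d2
      have e5 : V (j * h) - V ((i + 1) * h) = W (j * h) - W ((i + 1) * h) := by
        rw [e3, e4]; ring
      rw [e5] at d2
      have f1 := hle hi2 le_rfl (hij'.trans hj1)
      have f2 := hle hij' hi2 hj1
      have f3 := hle hj1 (hi2.trans hij') le_rfl
      have := dist_triangle4 (FreeNilpotent.sigLift N hu s)
        (FreeNilpotent.sigLift N hu ((i + 1) * h)) (FreeNilpotent.sigLift N hu (j * h))
        (FreeNilpotent.sigLift N hu t)
      linarith
    · have := hlocalW i hi s t hi1 hst hj2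
      linarith
    -- Cells are closed, so this order occurs only when `s = t` is a common grid point.
    · have hij' : ((j : ℝ) + 1) * h ≤ i * h := by
        have : (j : ℝ) + 1 ≤ i := by exact_mod_cast hij
        gcongr
      have : s = t := le_antisymm hst (hj2.trans (hij'.trans hi1))
      subst this
      rw [dist_self]
      positivity
  · intro j hj t ht1 ht2
    have d1 := hlocal j hj (j * h) t le_rfl ht1 ht2
    rw [hgrid j hj.le] at d1
    have d2 := mul_le_mul_of_nonneg_left (hθle j (h⁻¹ * (j * h) + -(j : ℝ)) (h⁻¹ * t + -(j : ℝ)))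
      (show 0 ≤ 2 * dist (x (j * h)) (x ((j + 1) * h)) by positivity)
    have := dist_triangle_left (FreeNilpotent.sigLift N hu t) (x t) (x (j * h))
    linarith

/-- Paths of finite `p`-variation lie in the closure of the smooth lifts in `q`-variation,
`q > p`. -/
theorem mem_closure_smoothLifts {d N : ℕ} {T p q : ℝ} (hT : 0 < T) (hp : 1 ≤ p) (hpq : p < q)
    (hq : 1 ≤ q) (x : BasedPath d N T) (hx : pVar p x.1 < ∞) (hfin : pVar q x.1 < ∞) :
    (⟨x, hfin⟩ : PVarPath d N T q hq) ∈ closure (smoothLifts d N T q hq) := by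
  have hp0 : 0 < p := zero_lt_one.trans_le hp
  -- The interpolants have merely integrable derivatives, so they are known only to lie in the
  -- closure of the smooth lifts.
  rw [← closure_closure]
  let x' : ℝ → FreeNilpotent d N := fun r => x.1 (Set.projIcc 0 T hT.le r)
  let V : ℝ → ℝ := fun r => pControl p x.1 (Set.projIcc 0 T hT.le r)
  have hVm := monotone_pControl hp0 hx
  have hV : Monotone V := fun r s hrs => hVm (Set.monotone_projIcc hT.le hrs)
  set C := V T - V 0 with hC
  set R := max (pVar p x.1).toReal (6 * C ^ (1 / p)) with hR
  refine mem_closure_of_uniform_approx hp hpq (R := R) ?_ fun δ hδ => ?_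
  · rw [← ENNReal.ofReal_toReal hx.ne]
    exact ENNReal.ofReal_le_ofReal (le_max_left _ _)
  have huc : UniformContinuous x.1 := CompactSpace.uniformContinuous_of_continuous x.1.continuous
  -- The interpolation error consists of three oscillations of `x` over one cell.
  obtain ⟨η, hη, hux⟩ := Metric.uniformContinuous_iff.1 huc (δ / 4) (by positivity)
  obtain ⟨n, hn⟩ := exists_nat_gt (T / η)
  have hn0 : 0 < (n : ℝ) := (by positivity : 0 < T / η).trans hn
  have hh : 0 < T / n := by positivity
  have hnT : (n : ℝ) * (T / n) = T := by field_simp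
  have hmesh : T / n < η := by
    rw [div_lt_iff₀ hn0]
    rw [div_lt_iff₀ hη] at hn
    linarith
  obtain ⟨u, hu, W, hW, hWV, hdist, hclose⟩ := exists_piecewise_almost_geodesic hp x' V hV
    (x.2 _ (by simp [Set.projIcc])) (fun s t hst =>
      dist_le_pControl_sub_rpow hp0 hx (Set.monotone_projIcc hT.le hst)) hh
      (n := n) (by rintro rfl; simp at hn0)
  rw [hnT] at hWV hdist
  have hpv : pVar p (sigPath N T hu).1 ≤ ENNReal.ofReal (6 * C ^ (1 / p)) := by
    refine pVar_le_of_control hp0 (W := fun t => W t) (by norm_num) (fun r s hrs => hW hrs)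
      (fun r s => ?_) fun r s hrs => hdist r s r.2.1 hrs s.2.2
    have h1 := hW s.2.2
    have h2 := hW r.2.1
    simp only [hC]
    linarith
  have hux' : ∀ s t : ℝ, |s - t| ≤ T / n → dist (x' s) (x' t) < δ / 4 := fun s t hst => by
    refine hux (lt_of_le_of_lt ?_ hmesh)
    refine le_trans ?_ hst
    rw [Subtype.dist_eq, Real.dist_eq, Set.coe_projIcc, Set.coe_projIcc]
    refine (abs_max_sub_max_le_max _ _ _ _).trans (max_le (by simp) ?_)
    exact (abs_min_sub_min_le_max _ _ _ _).trans (max_le (by simp) le_rfl)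
  refine ⟨⟨sigPath N T hu, ((pVar_interpolation hp0 hpq _).trans hpv).trans_lt
    ENNReal.ofReal_lt_top⟩, sigPath_mem_closure_smoothLifts hT.le (hp.trans_lt hpq) hu _,
    hpv.trans (ENNReal.ofReal_le_ofReal (le_max_right _ _)), fun t => ?_⟩
  obtain ⟨j, hj, hj1, hj2⟩ := exists_index_mem_Icc hh (by rintro rfl; simp at hn0)
    t.2.1 (t.2.2.trans hnT.ge)
  have h1 := hclose j hj t hj1 hj2
  have h2 := hux' (j * (T / n)) ((j + 1) * (T / n)) (by
    rw [← sub_mul, sub_add_cancel_left, neg_one_mul, abs_neg, abs_of_pos hh])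
  have h3 := hux' (j * (T / n)) t (by
    rw [abs_sub_comm, abs_of_nonneg (by linarith)]; linarith)
  have e : x' t = x.1 t := by simp [x']
  rw [e] at h1 h3
  change dist (x.1 t) (FreeNilpotent.sigLift N hu t) < δ
  rw [dist_comm]
  linarith

/-! ### The Hölder time change -/

theorem biVar_comp_le {T p : ℝ} {f : Set.Icc (0 : ℝ) T → Set.Icc (0 : ℝ) T → ℝ≥0∞}
    {s t : Set.Icc (0 : ℝ) T} {φ : Set.Icc (0 : ℝ) T → Set.Icc (0 : ℝ) T} (hφ : Monotone φ)
    (hs : ∀ r ≤ t, φ r ≤ s) : biVar p (fun a b => f (φ a) (φ b)) t ≤ biVar p f s :=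
  iSup_le fun D => le_iSup_of_le (ι := Dissection s)
    (f := fun D => (∑ i ∈ Finset.range D.1, f (D.2.1 i) (D.2.1 (i + 1)) ^ p) ^ (1 / p))
    (⟨D.1, fun i => φ (D.2.1 i), hφ.comp D.2.2.1, fun i => hs _ (D.2.2.2 i)⟩ : Dissection s) le_rfl

section HolderTime
variable {E : Type*} [MetricSpace E] {T : ℝ}

/-- Each increment is split into that of the path stopped at `s` and that of the path started at
`s`. Minkowski separates the two, and interpolation bounds the second by the oscillation on `[s,t]`.
-/
theorem pVarTo_le_add_of_oscillation {p q : ℝ} (hp : 1 ≤ p) (hpq : p < q)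
    (x : Set.Icc (0 : ℝ) T → E) {s t : Set.Icc (0 : ℝ) T} (hst : s ≤ t) {η : ℝ≥0∞}
    (hη : ∀ a b, s ≤ a → a ≤ b → b ≤ t → edist (x a) (x b) ≤ η) :
    pVarTo q x t ≤ pVarTo q x s + (η ^ (q - p) * pVar p x ^ p) ^ (1 / q) := by
  have hp0 : 0 < p := zero_lt_one.trans_le hp
  have hq : 1 ≤ q := hp.trans hpq.le
  let f : Set.Icc (0 : ℝ) T → Set.Icc (0 : ℝ) T → ℝ≥0∞ := fun a b => edist (x a) (x b)
  have h1 : biVar q f t ≤ biVar q (fun a b => f (a ⊓ s) (b ⊓ s) + f (a ⊔ s) (b ⊔ s)) t := by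
    refine biVar_mono (zero_le_one.trans hq) fun a b hab _ => ?_
    rcases le_total b s with hb | hb
    · rw [inf_eq_left.2 hb, inf_eq_left.2 (hab.trans hb)]
      exact le_self_add
    · rcases le_total a s with ha | ha
      · rw [inf_eq_left.2 ha, inf_eq_right.2 hb, sup_eq_right.2 ha, sup_eq_left.2 hb]
        exact edist_triangle _ _ _
      · rw [sup_eq_left.2 ha, sup_eq_left.2 hb]
        exact le_add_self
  refine h1.trans ((biVar_add_le hq).trans (add_le_add ?_ ?_))
  · exact biVar_comp_le (f := f) (φ := fun a => a ⊓ s) (fun a b h => inf_le_inf_right s h)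
      fun _ _ => inf_le_right
  · refine (biVar_interpolation (f := fun a b => f (a ⊔ s) (b ⊔ s)) hp0 hpq (η := η)
      fun a b hab hb => hη _ _ le_sup_right (sup_le_sup_right hab s) (sup_le hb hst)).trans ?_
    have hq0 : 0 < q := hp0.trans hpq
    gcongr
    exact (biVar_comp_le (f := f) (φ := fun a => a ⊔ s) (fun a b h => sup_le_sup_right h s)
      fun _ h => sup_le h hst).trans (pVarTo_le_pVar p x t)

variable {p q : ℝ} {x : C(Set.Icc (0 : ℝ) T, E)}

theorem pVarTo_ne_top {x : Set.Icc (0 : ℝ) T → E} (hx : pVar p x < ∞) (t : Set.Icc (0 : ℝ) T) :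
    pVarTo p x t ≠ ∞ := ((pVarTo_le_pVar p x t).trans_lt hx).ne

/-- Over short intervals uniform continuity makes the oscillation small; finite `p`-variation with
`p < q` then makes the added `q`-variation small. -/
theorem continuous_toReal_pVarTo (hp : 1 ≤ p) (hpq : p < q) (hx : pVar p x < ∞) :
    Continuous fun t => (pVarTo q x t).toReal := by
  have hp0 : 0 < p := zero_lt_one.trans_le hp
  have hxq : pVar q x < ∞ := (pVar_interpolation hp0 hpq x).trans_lt hx
  have huc : UniformContinuous x := CompactSpace.uniformContinuous_of_continuous x.continuous
  rw [Metric.continuous_iff']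
  intro t₀ ε hε
  obtain ⟨η, hη, hηε⟩ := exists_pos_interpolation_lt hp0 hpq (C := pVar p x ^ p)
    (ENNReal.rpow_ne_top_of_nonneg hp0.le hx.ne) (ENNReal.ofReal_pos.2 hε)
  obtain ⟨δ, hδ, hux⟩ := Metric.uniformContinuous_iff.1 huc η hη
  have key : ∀ s t : Set.Icc (0 : ℝ) T, s ≤ t → dist s t < δ →
      dist (pVarTo q x s).toReal (pVarTo q x t).toReal < ε := by
    intro s t hst hd
    have h1 := (pVarTo_le_add_of_oscillation hp hpq x hst (η := ENNReal.ofReal η)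
      fun a b ha hab hb => by
        rw [edist_dist]
        refine ENNReal.ofReal_le_ofReal (hux (lt_of_le_of_lt ?_ hd)).le
        rw [Subtype.dist_eq, Subtype.dist_eq, Real.dist_eq, Real.dist_eq, abs_sub_comm,
          abs_sub_comm (s : ℝ), abs_of_nonneg (sub_nonneg.2 (by exact_mod_cast hab)),
          abs_of_nonneg (sub_nonneg.2 (by exact_mod_cast hst))]
        have h2 : (s : ℝ) ≤ a := ha
        have h3 : (b : ℝ) ≤ t := hb
        linarith)
    have h2 := ENNReal.toReal_mono (ENNReal.add_ne_top.2
      ⟨pVarTo_ne_top hxq s, hηε.ne_top⟩) h1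
    rw [ENNReal.toReal_add (pVarTo_ne_top hxq s) hηε.ne_top] at h2
    have h3 := (ENNReal.toReal_lt_of_lt_ofReal hηε)
    have h4 : (pVarTo q x s).toReal ≤ (pVarTo q x t).toReal :=
      ENNReal.toReal_mono (pVarTo_ne_top hxq t) (pVarTo_mono_time _ _ hst)
    rw [Real.dist_eq, abs_sub_comm, abs_of_nonneg (sub_nonneg.2 h4)]
    linarith
  filter_upwards [Metric.ball_mem_nhds t₀ hδ] with t ht
  rcases le_total t t₀ with h | h
  · exact key t t₀ h ht
  · rw [dist_comm]
    exact key t₀ t h (by rwa [dist_comm])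

/-- The right end point of `[0,T]`. -/
def endTime (hT : 0 < T) : Set.Icc (0 : ℝ) T := ⟨T, hT.le, le_rfl⟩

theorem pVarTo_endTime (hT : 0 < T) (p : ℝ) (x : Set.Icc (0 : ℝ) T → E) :
    pVarTo p x (endTime hT) = pVar p x :=
  le_antisymm (pVarTo_le_pVar p x _) (iSup_le fun t => pVarTo_mono_time _ _
    (show t ≤ endTime hT from t.2.2))

theorem holderTime_of_pVar_ne_zero {x : Set.Icc (0 : ℝ) T → E} (h : pVar q x ≠ 0)
    (t : Set.Icc (0 : ℝ) T) :
    holderTime q x t = T * ((pVarTo q x t).toReal / (pVar q x).toReal) ^ q := by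
  rw [holderTime, if_neg h, ENNReal.toReal_div, ← ENNReal.toReal_rpow, ← ENNReal.toReal_rpow,
    Real.div_rpow ENNReal.toReal_nonneg ENNReal.toReal_nonneg]

theorem holderTime_of_pVar_eq_zero {x : Set.Icc (0 : ℝ) T → E} (h : pVar q x = 0)
    (t : Set.Icc (0 : ℝ) T) : holderTime q x t = t := by
  rw [holderTime, if_pos h]

theorem pVarTo_div_le_one {x : Set.Icc (0 : ℝ) T → E} (hxq : pVar q x < ∞)
    (t : Set.Icc (0 : ℝ) T) : (pVarTo q x t).toReal / (pVar q x).toReal ≤ 1 :=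
  div_le_one_of_le₀ (ENNReal.toReal_mono hxq.ne (pVarTo_le_pVar q x t)) ENNReal.toReal_nonneg

theorem holderTime_mem (hT : 0 < T) (hq : 0 < q) {x : Set.Icc (0 : ℝ) T → E}
    (hxq : pVar q x < ∞) (t : Set.Icc (0 : ℝ) T) : holderTime q x t ∈ Set.Icc 0 T := by
  by_cases h : pVar q x = 0
  · rw [holderTime_of_pVar_eq_zero h]
    exact t.2
  · rw [holderTime_of_pVar_ne_zero h]
    have h0 : 0 ≤ (pVarTo q x t).toReal / (pVar q x).toReal := by positivity
    exact ⟨by positivity, mul_le_of_le_one_right hT.le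
      (Real.rpow_le_one h0 (pVarTo_div_le_one hxq t) hq.le)⟩

theorem monotone_holderTime (hT : 0 < T) (hq : 0 < q) {x : Set.Icc (0 : ℝ) T → E}
    (hxq : pVar q x < ∞) : Monotone (holderTime q x) := by
  intro s t hst
  by_cases h : pVar q x = 0
  · rw [holderTime_of_pVar_eq_zero h, holderTime_of_pVar_eq_zero h]
    exact hst
  · rw [holderTime_of_pVar_ne_zero h, holderTime_of_pVar_ne_zero h]
    have := ENNReal.toReal_mono (pVarTo_ne_top hxq t) (pVarTo_mono_time _ _ hst)
    gcongr

theorem continuous_holderTime (hp : 1 ≤ p) (hpq : p < q) (hx : pVar p x < ∞) :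
    Continuous (holderTime q x) := by
  have hq0 : 0 < q := (zero_lt_one.trans_le hp).trans hpq
  by_cases h : pVar q x = 0
  · exact continuous_subtype_val.congr fun t => (holderTime_of_pVar_eq_zero h t).symm
  · refine Continuous.congr (continuous_const.mul
      (((continuous_toReal_pVarTo hp hpq hx).div_const (pVar q x).toReal).rpow_const
        fun _ => Or.inr hq0.le)) fun t => (holderTime_of_pVar_ne_zero h t).symm

theorem holderTime_zero {x : Set.Icc (0 : ℝ) T → E} (hq : 0 < q) {o : Set.Icc (0 : ℝ) T}
    (ho : (o : ℝ) = 0) : holderTime q x o = 0 := by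
  by_cases h : pVar q x = 0
  · rw [holderTime_of_pVar_eq_zero h, ho]
  · have h0 : pVarTo q x o ≤ 0 := by
      rw [pVarTo_eq_biVar, biVar_le_iff hq]
      intro D
      rw [Finset.sum_eq_zero]
      · exact bot_le
      · intro i _
        have e : ∀ i, D.2.1 i = o := fun i => le_antisymm (D.2.2.2 i) (by
          change (o : ℝ) ≤ D.2.1 i
          rw [ho]
          exact (D.2.1 i).2.1)
        rw [e, e, edist_self, ENNReal.zero_rpow_of_pos hq]
    rw [holderTime_of_pVar_ne_zero h, nonpos_iff_eq_zero.1 h0]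
    simp [hq.ne']

theorem holderTime_endTime (hT : 0 < T) {x : Set.Icc (0 : ℝ) T → E} (hxq : pVar q x < ∞) :
    holderTime q x (endTime hT) = T := by
  by_cases h : pVar q x = 0
  · rw [holderTime_of_pVar_eq_zero h]
    rfl
  · rw [holderTime_of_pVar_ne_zero h, pVarTo_endTime, div_self
      (ENNReal.toReal_ne_zero.2 ⟨h, hxq.ne⟩), Real.one_rpow, mul_one]

theorem exists_holderTime_eq (hT : 0 < T) (hp : 1 ≤ p) (hpq : p < q) (hx : pVar p x < ∞)
    (s : Set.Icc (0 : ℝ) T) : ∃ t, holderTime q x t = s := by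
  have hp0 : 0 < p := zero_lt_one.trans_le hp
  have hxq : pVar q x < ∞ := (pVar_interpolation hp0 hpq x).trans_lt hx
  have : PreconnectedSpace (Set.Icc (0 : ℝ) T) := Subtype.preconnectedSpace isPreconnected_Icc
  refine intermediate_value_univ (⟨0, le_rfl, hT.le⟩ : Set.Icc (0 : ℝ) T) (endTime hT)
    (continuous_holderTime hp hpq hx) ?_
  rw [holderTime_zero (hp0.trans hpq) rfl, holderTime_endTime hT hxq]
  exact s.2

/-- The control bound for `q`-variation, rewritten in the time `λ`. In particular `x` is constant on
the level sets of `λ`, hence factors through `λ` as a `1/q`-Hölder path. -/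
theorem dist_le_holderTime (hT : 0 < T) (hq : 0 < q) {x : Set.Icc (0 : ℝ) T → E}
    (hxq : pVar q x < ∞) (s t : Set.Icc (0 : ℝ) T) :
    dist (x s) (x t) ≤
      (pVar q x).toReal * (|holderTime q x s - holderTime q x t| / T) ^ (1 / q) := by
  wlog hst : s ≤ t generalizing s t
  · rw [dist_comm, abs_sub_comm]
    exact this t s (le_of_not_ge hst)
  by_cases h : pVar q x = 0
  · have : edist (x s) (x t) ≤ 0 := h ▸ edist_le_pVar hq x s t
    rw [nonpos_iff_eq_zero, edist_eq_zero] at this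
    rw [this, dist_self]
    positivity
  · have hA : 0 < (pVar q x).toReal := ENNReal.toReal_pos h hxq.ne
    have h1 := dist_le_pControl_sub_rpow hq hxq hst
    have hm := monotone_holderTime hT hq hxq hst
    have e : pControl q x t - pControl q x s =
        (pVar q x).toReal ^ q * (|holderTime q x s - holderTime q x t| / T) := by
      rw [abs_sub_comm, abs_of_nonneg (sub_nonneg.2 hm), holderTime_of_pVar_ne_zero h,
        holderTime_of_pVar_ne_zero h, Real.div_rpow ENNReal.toReal_nonneg hA.le,
        Real.div_rpow ENNReal.toReal_nonneg hA.le, pControl, pControl, ← ENNReal.toReal_rpow,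
        ← ENNReal.toReal_rpow]
      have : (pVar q x).toReal ^ q ≠ 0 := (Real.rpow_pos_of_pos hA q).ne'
      field_simp
    rw [e, Real.mul_rpow (by positivity) (by positivity), ← Real.rpow_mul hA.le,
      mul_one_div_cancel hq.ne', Real.rpow_one] at h1
    exact h1

/-- `P_q(x) = x ∘ τ` for every right inverse `τ` of `λ`, which is automatically monotone. -/
theorem exists_holderReparam_eq_comp (hT : 0 < T) (hp : 1 ≤ p) (hpq : p < q) (hx : pVar p x < ∞) :
    ∃ τ : Set.Icc (0 : ℝ) T → Set.Icc (0 : ℝ) T, Monotone τ ∧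
      (∀ s, holderTime q x (τ s) = s) ∧ ∀ s, holderReparam q x s = x (τ s) := by
  have hp0 : 0 < p := zero_lt_one.trans_le hp
  have hq0 : 0 < q := hp0.trans hpq
  have hxq : pVar q x < ∞ := (pVar_interpolation hp0 hpq x).trans_lt hx
  choose τ hτ using exists_holderTime_eq hT hp hpq hx
  have hm : Monotone τ := fun r s hrs => by
    rcases hrs.eq_or_lt with rfl | hrs
    · exact le_rfl
    · by_contra hlt
      have := monotone_holderTime hT hq0 hxq (le_of_not_ge hlt)
      rw [hτ, hτ] at this
      exact absurd hrs (not_lt.2 this)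
  have hc : Continuous fun s => x (τ s) := by
    rw [continuous_iff_continuousAt]
    intro s
    rw [ContinuousAt, tendsto_iff_dist_tendsto_zero]
    have h1 : Continuous fun r : Set.Icc (0 : ℝ) T =>
        (pVar q x).toReal * (|(r : ℝ) - s| / T) ^ (1 / q) := by
      refine continuous_const.mul (Continuous.rpow_const ?_ fun _ => Or.inr (by positivity))
      exact ((continuous_subtype_val.sub continuous_const).abs).div_const T
    have h2 := h1.tendsto s
    simp only [sub_self, abs_zero, zero_div] at h2
    rw [Real.zero_rpow (by positivity), mul_zero] at h2
    refine squeeze_zero (fun _ => dist_nonneg) (fun r => ?_) h2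
    have := dist_le_holderTime hT hq0 hxq (τ r) (τ s)
    rwa [hτ, hτ] at this
  -- This puts `x` in the main branch of the definition of `holderReparam`; its default value plays
  -- no role.
  have hex : pVar q x < ∞ ∧ ∃ y : C(Set.Icc (0 : ℝ) T, E),
      ∀ s t : Set.Icc (0 : ℝ) T, (s : ℝ) = holderTime q x t → y s = x t := by
    refine ⟨hxq, ⟨fun s => x (τ s), hc⟩, fun s t hst => ?_⟩
    have := dist_le_holderTime hT hq0 hxq (τ s) t
    rw [hτ, ← hst, sub_self, abs_zero, zero_div, Real.zero_rpow (by positivity), mul_zero] at this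
    exact dist_le_zero.1 this
  refine ⟨τ, hm, hτ, fun s => ?_⟩
  rw [holderReparam, dif_pos hex]
  exact hex.2.choose_spec s (τ s) (hτ s).symm

theorem holderReparam_holderTime (hT : 0 < T) (hp : 1 ≤ p) (hpq : p < q) (hx : pVar p x < ∞)
    {s t : Set.Icc (0 : ℝ) T} (h : (s : ℝ) = holderTime q x t) : holderReparam q x s = x t := by
  have hp0 : 0 < p := zero_lt_one.trans_le hp
  have hq0 : 0 < q := hp0.trans hpq
  obtain ⟨τ, -, hτ, he⟩ := exists_holderReparam_eq_comp hT hp hpq hx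
  rw [he]
  have := dist_le_holderTime hT hq0 ((pVar_interpolation hp0 hpq x).trans_lt hx) (τ s) t
  rw [hτ, ← h, sub_self, abs_zero, zero_div, Real.zero_rpow (by positivity), mul_zero] at this
  exact dist_le_zero.1 this

/-- `P_q(x) = x ∘ τ` with `τ` monotone, and `τ` carries dissections to dissections. The exponent `r`
is free because the bound is needed for `p`, not only for `q`. -/
theorem pVar_holderReparam_le (hT : 0 < T) (hp : 1 ≤ p) (hpq : p < q) (hx : pVar p x < ∞)
    (r : ℝ) : pVar r (holderReparam q x) ≤ pVar r x := by
  obtain ⟨τ, hm, -, he⟩ := exists_holderReparam_eq_comp hT hp hpq hx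
  refine iSup_le fun t => ?_
  simp only [pVarTo_eq_biVar, he]
  exact (biVar_comp_le (f := fun a b => edist (x a) (x b)) hm fun _ h => hm h).trans
    (pVarTo_le_pVar r x (τ t))

theorem dist_holderReparam_le (hT : 0 < T) (hp : 1 ≤ p) (hpq : p < q) (hx : pVar p x < ∞)
    (r s : Set.Icc (0 : ℝ) T) : dist (holderReparam q x r) (holderReparam q x s) ≤
      (pVar q x).toReal * (|(r : ℝ) - s| / T) ^ (1 / q) := by
  have hp0 : 0 < p := zero_lt_one.trans_le hp
  obtain ⟨τ, -, hτ, he⟩ := exists_holderReparam_eq_comp hT hp hpq hx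
  rw [he, he]
  have := dist_le_holderTime hT (hp0.trans hpq) ((pVar_interpolation hp0 hpq x).trans_lt hx)
    (τ r) (τ s)
  rwa [hτ, hτ] at this

end HolderTime

/-! ### Continuity and measurability of the reparametrisation -/

theorem exists_abs_rpow_sub_rpow_lt {q : ℝ} (hq : 0 ≤ q) {κ : ℝ} (hκ : 0 < κ) : ∃ ρ > 0,
    ∀ b ∈ Set.Icc (0 : ℝ) 1, ∀ c ∈ Set.Icc (0 : ℝ) 1, |b - c| < ρ → |b ^ q - c ^ q| < κ := by
  have h := isCompact_Icc.uniformContinuousOn_of_continuous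
    (s := Set.Icc (0 : ℝ) 1) (f := fun b : ℝ => b ^ q)
    (Real.continuous_rpow_const hq).continuousOn
  exact Metric.uniformContinuousOn_iff.1 h κ hκ

theorem abs_div_sub_div_le {a A b B η : ℝ} (ha : 0 ≤ b) (hA : 0 < A) (hB : 0 < B) (hbB : b ≤ B)
    (h1 : |b - a| ≤ η) (h2 : |B - A| ≤ η) : |b / B - a / A| ≤ 2 * η / A := by
  have e : b / B - a / A = ((b - a) - b / B * (B - A)) / A := by
    field_simp
    ring
  have h3 : |b / B| ≤ 1 := by
    rw [abs_of_nonneg (by positivity)]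
    exact div_le_one_of_le₀ hbB hB.le
  rw [e, abs_div, abs_of_pos hA]
  gcongr
  calc |(b - a) - b / B * (B - A)| ≤ |b - a| + |b / B * (B - A)| := abs_sub _ _
    _ ≤ η + 1 * η := by
      rw [abs_mul]
      gcongr
    _ = 2 * η := by ring

section Continuity
variable {d N : ℕ} {T p q : ℝ}

theorem abs_pVarTo_sub_le (hp : 1 ≤ p) {x y : Set.Icc (0 : ℝ) T → FreeNilpotent d N}
    (hx : pVar p x < ∞) (hy : pVar p y < ∞) {η : ℝ} (hη : 0 ≤ η)
    (h : pVarDist p x y ≤ ENNReal.ofReal η) (t : Set.Icc (0 : ℝ) T) :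
    |(pVarTo p x t).toReal - (pVarTo p y t).toReal| ≤ η := by
  have key : ∀ {x y : Set.Icc (0 : ℝ) T → FreeNilpotent d N}, pVar p y < ∞ →
      pVarDist p x y ≤ ENNReal.ofReal η → (pVarTo p x t).toReal - (pVarTo p y t).toReal ≤ η := by
    intro x y hy h
    have h1 := (pVarTo_le_add_pVarDist hp x y t).trans (add_le_add le_rfl h)
    have h2 := ENNReal.toReal_mono (ENNReal.add_ne_top.2
      ⟨pVarTo_ne_top hy t, ENNReal.ofReal_ne_top⟩) h1
    rw [ENNReal.toReal_add (pVarTo_ne_top hy t) ENNReal.ofReal_ne_top,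
      ENNReal.toReal_ofReal hη] at h2
    linarith
  rw [abs_sub_le_iff]
  exact ⟨key hy h, key hx (by rwa [pVarDist_comm])⟩

/-- Along paths of bounded `p`-variation, `P_q` is continuous for the uniform distance. -/
theorem exists_dist_holderReparam_lt (hT : 0 < T) (hp : 1 ≤ p) (hpq : p < q) {R : ℝ} (hR : 0 ≤ R)
    {x : C(Set.Icc (0 : ℝ) T, FreeNilpotent d N)} (hx : pVar p x ≤ ENNReal.ofReal R) {ε : ℝ}
    (hε : 0 < ε) : ∃ δ > 0, ∀ y : C(Set.Icc (0 : ℝ) T, FreeNilpotent d N),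
      pVar p y ≤ ENNReal.ofReal R → (∀ t, dist (x t) (y t) < δ) →
        ∀ s, dist (holderReparam q x s) (holderReparam q y s) < ε := by
  have hp0 : 0 < p := zero_lt_one.trans_le hp
  have hq0 : 0 < q := hp0.trans hpq
  have hq : 1 ≤ q := hp.trans hpq.le
  have hxp : pVar p x < ∞ := hx.trans_lt ENNReal.ofReal_lt_top
  have hxq : pVar q x < ∞ := (pVar_interpolation hp0 hpq x).trans_lt hxp
  obtain ⟨τ, -, hτ, hτx⟩ := exists_holderReparam_eq_comp hT hp hpq hxp
  by_cases h0 : pVar q x = 0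
  -- For constant `x` the time changes of nearby `y` need not be close to that of `x`, but every
  -- time change of `x` gives the same path.
  · refine ⟨ε, hε, fun y hy hxy s => ?_⟩
    obtain ⟨σ, -, hσ, hσy⟩ := exists_holderReparam_eq_comp hT hp hpq
      (hy.trans_lt ENNReal.ofReal_lt_top)
    have h1 : edist (x (τ s)) (x (σ s)) ≤ 0 := h0 ▸ edist_le_pVar hq0 x _ _
    rw [nonpos_iff_eq_zero, edist_eq_zero] at h1
    rw [hτx, hσy, h1]
    exact hxy _
  · set A := (pVar q x).toReal with hA
    have hA0 : 0 < A := ENNReal.toReal_pos h0 hxq.ne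
    obtain ⟨κ, hκ, hκε⟩ : ∃ κ > 0, ∀ b : ℝ, |b| < κ → R * |b| ^ (1 / q) < ε / 2 := by
      have hc : Continuous fun b : ℝ => R * |b| ^ (1 / q) := continuous_const.mul
        (continuous_abs.rpow_const fun _ => Or.inr (by positivity))
      obtain ⟨κ, hκ, h⟩ := Metric.continuous_iff.1 hc 0 (ε / 2) (half_pos hε)
      refine ⟨κ, hκ, fun b hb => ?_⟩
      have := h b (by rwa [Real.dist_eq, sub_zero])
      rw [abs_zero, Real.zero_rpow (by positivity), mul_zero, Real.dist_eq, sub_zero] at this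
      exact (le_abs_self _).trans_lt this
    obtain ⟨ρ, hρ, hρκ⟩ := exists_abs_rpow_sub_rpow_lt hq0.le hκ
    -- `A / 2` keeps the total variation `B` of `y` positive; `ρ * A / 4` keeps the quotients within
    -- `2 * η / A < ρ` of each other.
    set η := min (A / 2) (ρ * A / 4) with hη
    have hη0 : 0 < η := by positivity
    obtain ⟨δ, hδ, hd⟩ := exists_pVarDist_le (d := d) (N := N) (T := T) hp hpq R
      (ENNReal.ofReal_pos.2 hη0)
    refine ⟨min δ (ε / 2), by positivity, fun y hy hxy s => ?_⟩
    have hyp : pVar p y < ∞ := hy.trans_lt ENNReal.ofReal_lt_top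
    have hyq : pVar q y < ∞ := (pVar_interpolation hp0 hpq y).trans_lt hyp
    have hD := hd y x hy hx fun t => by
      rw [dist_comm]; exact (hxy t).trans_le (min_le_left _ _)
    have hV := abs_pVarTo_sub_le hq hyq hxq hη0.le hD
    set t := τ s with ht
    set B := (pVar q y).toReal with hB
    have hVT := hV (endTime hT)
    rw [pVarTo_endTime, pVarTo_endTime, ← hA, ← hB] at hVT
    have hB0 : 0 < B := by
      have h1 := (abs_sub_le_iff.1 hVT).2
      have h2 : η ≤ A / 2 := min_le_left _ _
      linarith
    have hy0 : pVar q y ≠ 0 := fun h => by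
      rw [hB, h] at hB0
      simp at hB0
    have hfrac : |(pVarTo q y t).toReal / B - (pVarTo q x t).toReal / A| < ρ := by
      refine (abs_div_sub_div_le ENNReal.toReal_nonneg hA0 hB0
        (ENNReal.toReal_mono hyq.ne (pVarTo_le_pVar q y t)) (hV t) hVT).trans_lt ?_
      rw [div_lt_iff₀ hA0]
      have h2 : η ≤ ρ * A / 4 := min_le_right _ _
      have : 0 < ρ * A := by positivity
      linarith
    have htime := hρκ _ ⟨by positivity, pVarTo_div_le_one hyq t⟩ _
      ⟨by positivity, pVarTo_div_le_one hxq t⟩ hfrac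
    have e : |(holderTime q y t - s) / T| < κ := by
      rw [← hτ s, ← ht, holderTime_of_pVar_ne_zero h0, holderTime_of_pVar_ne_zero hy0, ← mul_sub,
        mul_div_cancel_left₀ _ hT.ne']
      exact htime
    -- `y_t` is the value of `P_q(y)` at `s' = λ_y(t)`, which is close to `s = λ_x(t)`; Hölder
    -- continuity of `P_q(y)` bridges the gap.
    let s' : Set.Icc (0 : ℝ) T := ⟨holderTime q y t, holderTime_mem hT hq0 hyq t⟩
    have h1 : holderReparam q y s' = y t := holderReparam_holderTime hT hp hpq hyp rfl
    have h2 : dist (y t) (holderReparam q y s) < ε / 2 := by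
      rw [← h1]
      refine (dist_holderReparam_le hT hp hpq hyp s' s).trans_lt (lt_of_le_of_lt ?_ (hκε _ e))
      rw [abs_div, abs_of_pos hT]
      refine mul_le_mul_of_nonneg_right ?_ (by positivity)
      exact ENNReal.toReal_le_of_le_ofReal hR ((pVar_interpolation hp0 hpq y).trans hy)
    have h3 : dist (x t) (y t) < ε / 2 := (hxy t).trans_le (min_le_right _ _)
    rw [hτx]
    exact (dist_triangle _ _ _).trans_lt (by linarith)

theorem holderReparam_zero (hT : 0 < T) (hp : 1 ≤ p) (hpq : p < q) {x : BasedPath d N T}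
    (hx : pVar p x.1 < ∞) (t : Set.Icc (0 : ℝ) T) (ht : (t : ℝ) = 0) :
    holderReparam q x.1 t = 1 := by
  have hq0 : 0 < q := (zero_lt_one.trans_le hp).trans hpq
  rw [holderReparam_holderTime hT hp hpq hx (s := t) (t := t) (by rw [holderTime_zero hq0 ht, ht])]
  exact x.2 t ht

theorem exists_geometricPath_eq_holderReparam (hT : 0 < T) (hp : 1 ≤ p) (hpq : p < q)
    (hq : 1 ≤ q) (x : BasedPath d N T) (hx : pVar p x.1 < ∞) :
    ∃ y : GeometricPath d N T q hq, y.path = holderReparam q x.1 := by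
  have hp0 : 0 < p := zero_lt_one.trans_le hp
  have hfin : pVar p (holderReparam q x.1) < ∞ :=
    (pVar_holderReparam_le hT hp hpq hx p).trans_lt hx
  exact ⟨⟨_, mem_closure_smoothLifts hT hp hpq hq
    ⟨holderReparam q x.1, holderReparam_zero hT hp hpq hx⟩ hfin
    ((pVar_interpolation hp0 hpq _).trans_lt hfin)⟩, rfl⟩

theorem BasedPath.dist_apply_le (x y : BasedPath d N T) (t : Set.Icc (0 : ℝ) T) :
    dist (x.1 t) (y.1 t) ≤ dist x y :=
  ContinuousMap.dist_apply_le_dist (f := x.1) (g := y.1) t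

theorem BasedPath.continuous_eval (t : Set.Icc (0 : ℝ) T) :
    Continuous fun x : BasedPath d N T => x.1 t :=
  (LipschitzWith.of_dist_le_mul (K := 1) fun x y => by
    simpa using BasedPath.dist_apply_le x y t).continuous

/-- For each dissection the bound is a closed condition on finitely many values of the path. -/
theorem isClosed_setOf_pVar_le (hp : 0 < p) (C : ℝ≥0∞) :
    IsClosed {x : BasedPath d N T | pVar p x.1 ≤ C} := by
  have e : {x : BasedPath d N T | pVar p x.1 ≤ C} = ⋂ (t : Set.Icc (0 : ℝ) T) (D : Dissection t),
      {x | ∑ i ∈ Finset.range D.1, edist (x.1 (D.2.1 i)) (x.1 (D.2.1 (i + 1))) ^ p ≤ C ^ p} := by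
    ext x
    simp only [Set.mem_ofPred_eq, Set.mem_iInter, pVar_le_iff hp]
  rw [e]
  refine isClosed_iInter fun t => isClosed_iInter fun D => isClosed_le ?_ continuous_const
  refine continuous_finsetSum _ fun i _ => ENNReal.continuous_rpow_const.comp ?_
  exact (BasedPath.continuous_eval _).edist (BasedPath.continuous_eval _)

/-- `P_q` keeps the `p`-variation bounded by `R`, so uniform closeness of the images improves to
closeness in `q`-variation. -/
theorem continuousOn_of_path_eq_holderReparam (hT : 0 < T) (hp : 1 ≤ p) (hpq : p < q)
    {hq : 1 ≤ q} {Φ : BasedPath d N T → GeometricPath d N T q hq}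
    (hΦ : ∀ x : BasedPath d N T, pVar p x.1 < ∞ → (Φ x).path = holderReparam q x.1) {R : ℝ}
    (hR : 0 ≤ R) : ContinuousOn Φ {x | pVar p x.1 ≤ ENNReal.ofReal R} := by
  intro x hx
  rw [ContinuousWithinAt, EMetric.tendsto_nhds]
  intro ε hε
  obtain ⟨ε', hε', hεε'⟩ := exists_between hε
  obtain ⟨η, hη, hηd⟩ := exists_pVarDist_le (d := d) (N := N) (T := T) hp hpq R hε'
  obtain ⟨δ, hδ, hδη⟩ := exists_dist_holderReparam_lt hT hp hpq hR hx hη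
  filter_upwards [inter_mem_nhdsWithin _ (Metric.ball_mem_nhds x hδ)] with y hy
  have hxp : pVar p x.1 < ∞ := lt_of_le_of_lt hx ENNReal.ofReal_lt_top
  have hyp : pVar p y.1 < ∞ := lt_of_le_of_lt hy.1 ENNReal.ofReal_lt_top
  refine lt_of_le_of_lt ?_ hεε'
  change pVarDist q (Φ y).path (Φ x).path ≤ ε'
  rw [hΦ x hxp, hΦ y hyp]
  refine hηd _ _ ((pVar_holderReparam_le hT hp hpq hyp p).trans hy.1)
    ((pVar_holderReparam_le hT hp hpq hxp p).trans hx) fun t => ?_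
  rw [dist_comm]
  refine hδη y.1 hy.1 (fun t => (BasedPath.dist_apply_le x y t).trans_lt ?_) t
  rw [dist_comm]
  exact hy.2

theorem measurable_pVar (hp : 0 < p) : Measurable fun x : BasedPath d N T => pVar p x.1 :=
  measurable_of_Iic fun C => (isClosed_setOf_pVar_le hp C).measurableSet

/-- The map `P_q` into `C_o^{0,q-var}` is Borel, and continuous on bounded sets of
`p`-variation. -/
theorem exists_measurable_holderReparam (hT : 0 < T) (hp : 1 ≤ p) (hpq : p < q) (hq : 1 ≤ q) :
    ∃ Φ : BasedPath d N T → GeometricPath d N T q hq, Measurable Φ ∧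
      (∀ x : BasedPath d N T, pVar p x.1 < ∞ → (Φ x).path = holderReparam q x.1) ∧
      ∀ R : ℕ, ContinuousOn Φ {x | pVar p x.1 ≤ ENNReal.ofReal R} := by
  have hp0 : 0 < p := zero_lt_one.trans_le hp
  have h1 : pVar p (ContinuousMap.const (Set.Icc (0 : ℝ) T) (1 : FreeNilpotent d N)) < ∞ := by
    refine lt_of_le_of_lt (iSup_le fun t => (?_ : _ ≤ (0 : ℝ≥0∞))) ENNReal.zero_lt_top
    rw [pVarTo_eq_biVar, biVar_le_iff hp0]
    intro D
    simp [hp0]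
  obtain ⟨y₀, -⟩ := exists_geometricPath_eq_holderReparam hT hp hpq hq
    (⟨ContinuousMap.const _ 1, fun _ _ => rfl⟩ : BasedPath d N T) h1
  have : Nonempty (GeometricPath d N T q hq) := ⟨y₀⟩
  choose! F hF using exists_geometricPath_eq_holderReparam (d := d) (N := N) hT hp hpq hq
  classical
  let Φ : BasedPath d N T → GeometricPath d N T q hq := fun x => if pVar p x.1 < ∞ then F x else y₀
  have hΦ : ∀ x : BasedPath d N T, pVar p x.1 < ∞ → (Φ x).path = holderReparam q x.1 :=
    fun x hx => by simp only [Φ, if_pos hx, hF x hx]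
  have hcont : ∀ R : ℕ, ContinuousOn Φ {x | pVar p x.1 ≤ ENNReal.ofReal R} := fun R =>
    continuousOn_of_path_eq_holderReparam hT hp hpq hΦ R.cast_nonneg
  refine ⟨Φ, measurable_of_isClosed fun S hS => ?_, hΦ, hcont⟩
  -- On each ball the preimage of a closed set is closed; on the remaining set of infinite
  -- `p`-variation `Φ` is the constant `y₀`.
  have e : Φ ⁻¹' S = (⋃ R : ℕ, {x | pVar p x.1 ≤ ENNReal.ofReal R} ∩ Φ ⁻¹' S) ∪
      ({x | pVar p x.1 = ∞} ∩ Φ ⁻¹' S) := by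
    ext x
    simp only [Set.mem_union, Set.mem_iUnion, Set.mem_inter_iff, Set.mem_ofPred_eq]
    refine ⟨fun h => ?_, by rintro (⟨_, -, h⟩ | ⟨-, h⟩) <;> exact h⟩
    rcases eq_or_ne (pVar p x.1) ∞ with hx | hx
    · exact Or.inr ⟨hx, h⟩
    · obtain ⟨R, hR⟩ := exists_nat_ge (pVar p x.1).toReal
      exact Or.inl ⟨R, (ENNReal.le_ofReal_iff_toReal_le hx R.cast_nonneg).2 hR, h⟩
  rw [e]
  refine (MeasurableSet.iUnion fun R => ?_).union ?_
  · exact ((hcont R).preimage_isClosed_of_isClosed (isClosed_setOf_pVar_le hp0 _) hS).measurableSet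
  · have e2 : {x : BasedPath d N T | pVar p x.1 = ∞} ∩ Φ ⁻¹' S =
        {x | pVar p x.1 = ∞} ∩ {_x | y₀ ∈ S} := by
      ext x
      simp only [Set.mem_inter_iff, Set.mem_ofPred_eq, Set.mem_preimage]
      refine and_congr_right fun hx => ?_
      simp only [Φ, hx, lt_irrefl, if_false]
    rw [e2]
    exact (measurable_pVar hp0 (measurableSet_singleton ∞)).inter (MeasurableSet.const _)

end Continuity

/-! ### Convergence in law -/

/-- A mapping theorem: `Φ` need only be continuous on closed sets carrying almost all the mass. -/
theorem tendstoInDistribution_comp_of_continuousOn {S S' : Type*} [TopologicalSpace S]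
    [MeasurableSpace S] [OpensMeasurableSpace S] [HasOuterApproxClosed S] [TopologicalSpace S']
    [MeasurableSpace S'] [OpensMeasurableSpace S'] {Ω : ℕ → Type*}
    [∀ n, MeasurableSpace (Ω n)] {μ : ∀ n, Measure (Ω n)} [∀ n, IsProbabilityMeasure (μ n)]
    {Ω' : Type*} [MeasurableSpace Ω'] {μ' : Measure Ω'} [IsProbabilityMeasure μ']
    {X : ∀ n, Ω n → S} {Z : Ω' → S} (hX : TendstoInDistribution X atTop Z μ μ') {Φ : S → S'}
    (hΦ : Measurable Φ)
    (hK : ∀ ε : ℝ≥0∞, 0 < ε → ∃ K : Set S, IsClosed K ∧ ContinuousOn Φ K ∧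
      ∀ n, (μ n).map (X n) Kᶜ ≤ ε) :
    TendstoInDistribution (fun n ω => Φ (X n ω)) atTop (fun ω => Φ (Z ω)) μ μ' := by
  have hXm := hX.forall_aemeasurable
  have hZm := hX.aemeasurable_limit
  refine ⟨fun n => hΦ.comp_aemeasurable (hXm n), hΦ.comp_aemeasurable hZm, ?_⟩
  refine tendsto_of_forall_isClosed_limsup_le' fun F hF => ?_
  have eX : ∀ n, (μ n).map (fun ω => Φ (X n ω)) F = (μ n).map (X n) (Φ ⁻¹' F) := fun n => by
    rw [← Measure.map_apply hΦ hF.measurableSet, AEMeasurable.map_map_of_aemeasurable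
      hΦ.aemeasurable (hXm n)]
    rfl
  have eZ : μ'.map (fun ω => Φ (Z ω)) F = μ'.map Z (Φ ⁻¹' F) := by
    rw [← Measure.map_apply hΦ hF.measurableSet, AEMeasurable.map_map_of_aemeasurable
      hΦ.aemeasurable hZm]
    rfl
  simp only [ProbabilityMeasure.coe_mk, eX, eZ]
  refine ENNReal.le_of_forall_pos_le_add fun ε hε _ => ?_
  obtain ⟨K, hKc, hKΦ, hKμ⟩ := hK ε (by exact_mod_cast hε)
  -- `Φ ⁻¹' F` need not be closed, but its part in `K` is; portmanteau applies to that part, and the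
  -- rest has mass at most `ε`.
  have hclosed : IsClosed (K ∩ Φ ⁻¹' F) := hKΦ.preimage_isClosed_of_isClosed hKc hF
  have hlim := ProbabilityMeasure.limsup_measure_closed_le_of_tendsto hX.tendsto hclosed
  simp only [ProbabilityMeasure.coe_mk] at hlim
  calc atTop.limsup (fun n => (μ n).map (X n) (Φ ⁻¹' F))
      ≤ atTop.limsup (fun n => (μ n).map (X n) (K ∩ Φ ⁻¹' F) + ε) := by
        refine limsup_le_limsup (Eventually.of_forall fun n => ?_)
        refine (measure_mono (t := (K ∩ Φ ⁻¹' F) ∪ Kᶜ) fun x hx => ?_).trans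
          ((measure_union_le _ _).trans (add_le_add le_rfl (hKμ n)))
        by_cases h : x ∈ K
        · exact Or.inl ⟨h, hx⟩
        · exact Or.inr h
    _ ≤ atTop.limsup (fun n => (μ n).map (X n) (K ∩ Φ ⁻¹' F)) + ε := by
        rw [limsup_add_const atTop _ _ (by isBoundedDefault) (by isBoundedDefault)]
    _ ≤ μ'.map Z (Φ ⁻¹' F) + ε :=
        add_le_add (hlim.trans (measure_mono Set.inter_subset_right)) le_rfl

/-- The mass outside bounded sets of `p`-variation is uniformly small. -/
theorem exists_map_pVar_compl_le {d N : ℕ} {T p : ℝ} (hp : 0 < p) {Ω : ℕ → Type*}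
    [∀ n, MeasurableSpace (Ω n)] {μ : ∀ n, Measure (Ω n)} {X : ∀ n, Ω n → BasedPath d N T}
    (hX : ∀ n, AEMeasurable (X n) (μ n)) (hfin : ∀ n, ∀ᵐ ω ∂(μ n), pVar p (X n ω).1 < ∞)
    (htight : IsTightMeasureSet
      (Set.range fun n => (μ n).map fun ω => (pVar p (X n ω).1).toReal))
    {ε : ℝ≥0∞} (hε : 0 < ε) :
    ∃ R : ℕ, ∀ n, (μ n).map (X n) {x | pVar p x.1 ≤ ENNReal.ofReal R}ᶜ ≤ ε := by
  obtain ⟨K, hK, hKμ⟩ := isTightMeasureSet_iff_exists_isCompact_measure_compl_le.1 htight ε hε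
  obtain ⟨r, hr⟩ := hK.isBounded.subset_closedBall (0 : ℝ)
  obtain ⟨R, hR⟩ := exists_nat_ge r
  refine ⟨R, fun n => ?_⟩
  have h1 := hKμ _ ⟨n, rfl⟩
  have hm : AEMeasurable (fun ω => (pVar p (X n ω).1).toReal) (μ n) :=
    ((measurable_pVar hp).comp_aemeasurable (hX n)).ennreal_toReal
  rw [Measure.map_apply_of_aemeasurable hm hK.isClosed.measurableSet.compl] at h1
  rw [Measure.map_apply_of_aemeasurable (hX n)
    (isClosed_setOf_pVar_le hp _).measurableSet.compl]
  refine le_trans (measure_mono_ae ?_) h1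
  -- Finiteness is essential: `toReal` sends `∞` to `0`, so tightness of the real variables alone
  -- would not exclude infinite variation.
  filter_upwards [hfin n] with ω hω h hmem
  refine h ((ENNReal.le_ofReal_iff_toReal_le hω.ne R.cast_nonneg).2 ?_)
  have := hr hmem
  rw [mem_closedBall_zero_iff, Real.norm_eq_abs] at this
  exact (le_abs_self _).trans (this.trans hR)

/-- Infinite `p`-variation lies in the complement of every ball. These complements are open, so
portmanteau bounds the limiting mass by the uniform `ε` of tightness. -/
theorem ae_pVar_lt_top_of_tendstoInDistribution {d N : ℕ} {T p : ℝ} (hp : 0 < p) {Ω : ℕ → Type*}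
    [∀ n, MeasurableSpace (Ω n)] {μ : ∀ n, Measure (Ω n)} [∀ n, IsProbabilityMeasure (μ n)]
    {Ω' : Type*} [MeasurableSpace Ω'] {μ' : Measure Ω'} [IsProbabilityMeasure μ']
    {X : ∀ n, Ω n → BasedPath d N T} {Z : Ω' → BasedPath d N T}
    (hX : TendstoInDistribution X atTop Z μ μ')
    (hfin : ∀ n, ∀ᵐ ω ∂(μ n), pVar p (X n ω).1 < ∞)
    (htight : IsTightMeasureSet
      (Set.range fun n => (μ n).map fun ω => (pVar p (X n ω).1).toReal)) :
    ∀ᵐ ω ∂μ', pVar p (Z ω).1 < ∞ := by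
  rw [ae_iff]
  refine nonpos_iff_eq_zero.1 (ENNReal.le_of_forall_pos_le_add fun ε hε _ => ?_)
  obtain ⟨R, hR⟩ := exists_map_pVar_compl_le hp hX.forall_aemeasurable hfin htight
    (ε := ε) (by exact_mod_cast hε)
  have hcl := isClosed_setOf_pVar_le (d := d) (N := N) (T := T) hp (ENNReal.ofReal R)
  have hlim := ProbabilityMeasure.le_liminf_measure_open_of_tendsto hX.tendsto hcl.isOpen_compl
  simp only [ProbabilityMeasure.coe_mk] at hlim
  rw [Measure.map_apply_of_aemeasurable hX.aemeasurable_limit hcl.measurableSet.compl] at hlim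
  rw [zero_add]
  have hsub : {ω | ¬ pVar p (Z ω).1 < ∞} ⊆ Z ⁻¹' {x | pVar p x.1 ≤ ENNReal.ofReal R}ᶜ :=
    fun ω hω h => hω.elim (lt_of_le_of_lt h ENNReal.ofReal_lt_top)
  refine (measure_mono hsub).trans (hlim.trans ?_)
  refine (liminf_le_liminf (Eventually.of_forall hR)).trans ?_
  rw [liminf_const]

theorem mainTheorem6 (d N : ℕ) (hN : 1 ≤ N) (T : ℝ) (hT : 0 < T) (p : ℝ) (hp : 1 ≤ p)
    {Ω : ℕ → Type*} [∀ n, MeasurableSpace (Ω n)] (μ : ∀ n, Measure (Ω n))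
    [∀ n, IsProbabilityMeasure (μ n)]
    {Ω' : Type*} [MeasurableSpace Ω'] (μ' : Measure Ω') [IsProbabilityMeasure μ']
    (X : ∀ n, Ω n → BasedPath d N T) (Z : Ω' → BasedPath d N T)
    (hfin : ∀ n, ∀ᵐ ω ∂(μ n), pVar p (X n ω).1 < ∞)
    (htight : IsTightMeasureSet
      (Set.range fun n => (μ n).map fun ω => (pVar p (X n ω).1).toReal))
    (hconv : TendstoInDistribution X atTop Z μ μ')
    (p' : ℝ) (hp' : p < p') :
    (∀ᵐ ω ∂μ', pVar p' (Z ω).1 < ∞) ∧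
      ∃ (Y : ∀ n, Ω n → GeometricPath d N T p' (hp.trans hp'.le))
        (W : Ω' → GeometricPath d N T p' (hp.trans hp'.le)),
        (∀ n, ∀ᵐ ω ∂(μ n), (Y n ω).path = holderReparam p' (X n ω).1) ∧
        (∀ᵐ ω ∂μ', (W ω).path = holderReparam p' (Z ω).1) ∧
        TendstoInDistribution Y atTop W μ μ' := by
  have hp0 : 0 < p := zero_lt_one.trans_le hp
  have hZ := ae_pVar_lt_top_of_tendstoInDistribution hp0 hconv hfin htight
  -- One Borel map, defined on all based paths, realises `P_{p'}` wherever the `p`-variation is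
  -- finite, hence almost surely for every `X n` and for `Z`.
  obtain ⟨Φ, hΦm, hΦ, hΦc⟩ := exists_measurable_holderReparam (d := d) (N := N) hT hp hp'
    (hp.trans hp'.le)
  refine ⟨hZ.mono fun ω h => (pVar_interpolation hp0 hp' _).trans_lt h,
    fun n ω => Φ (X n ω), fun ω => Φ (Z ω), fun n => (hfin n).mono fun ω h => hΦ _ h,
    hZ.mono fun ω h => hΦ _ h, tendstoInDistribution_comp_of_continuousOn hconv hΦm fun ε hε => ?_⟩
  obtain ⟨R, hR⟩ := exists_map_pVar_compl_le hp0 hconv.forall_aemeasurable hfin htight hε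
  exact ⟨_, isClosed_setOf_pVar_le hp0 _, hΦc R, hR⟩
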